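/- Let $T=[0,1]^d$ with the $\ell_\infty$ metric. For a data set $D\in T^n$ let $\mu_D$ be its empirical measure. For $1\le s\le d$ and probability measures $\mu,\nu$ on $T$ define the utility loss $$\mathcal U_s(\mu,\nu)=\max_{S\subset\{1,\dots,d\},\,|S|=s} W_1\big(P^S_\#\mu,\,P^S_\#\nu\big),$$ where $P^S_\#\mu$ is the marginal of $\mu$ on the coordinates in $S$ and $W_1$ is the $1$-Wasserstein distance on $[0,1]^S$ with respect to the $\ell_\infty$ metric. A randomized algorithm $\mathcal A$ takes a data set $D\in T^n$ and returns a random probability measure $\mathcal A(D)$ on $T$; it is $\varepsilon$-DP if $\mathbb P(\mathcal A(D)\in E)\le e^{\varepsilon}\,\mathbb P(\mathcal A(D')\in E)$ for all measurable sets $E$ of probability measures and all data sets $D,D'$ that differ in a single entry. (i) For every $s\ge 1$ there is a constant $C_s>0$, depending only on $s$, such that for all $d\ge s$, $n\in\mathbb N$ and $\varepsilon>0$ with $n\varepsilon\ge 2$ there is an $\varepsilon$-DP algorithm $\mathcal A$, whose output is almost surely finitely supported, with $$\mathbb E\,\mathcal U_s(\mu_D,\mathcal A(D))\;\le\; C_s\left(\frac{d^s\,\log^{3/2}(n\varepsilon)}{n\varepsilon}\right)^{1/s}\qquad\text{for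 every } D\in T^n .$$ (ii) The rate $n^{-1/s}$ is minimax optimal as a function of $n$, up to logarithmic factors: for every $s\ge1$ and $\varepsilon>0$ there is a constant $c_{s,\varepsilon}>0$ such that for all $d\ge s$, all $n\ge1$ and every $\varepsilon$-DP algorithm $\mathcal A$ there is a data set $D\in T^n$ with $$\mathbb E\,\mathcal U_s(\mu_D,\mathcal A(D))\;\ge\; c_{s,\varepsilon}\, n^{-1/s}.$$ -/

import Mathlib

open MeasureTheory
open scoped ENNReal

noncomputable section

/-- The hypercube `[0,1]^d`. Its metric is the `ℓ_∞` metric, the default one on `Fin d → _`. -/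
abbrev Cube (d : ℕ) : Type := Fin d → unitInterval

/-- The coordinate projection `[0,1]^d → [0,1]^S`. The target again carries the `ℓ_∞` metric. -/
def coordProj {d : ℕ} (S : Finset (Fin d)) (x : Cube d) : S → unitInterval :=
  fun i => x i

/-- `π` is a coupling of `μ` and `ν`: a measure on the product with these two marginals. -/
def IsCouplingOf {X : Type*} [MeasurableSpace X] (π : Measure (X × X)) (μ ν : Measure X) : Prop :=
  π.map Prod.fst = μ ∧ π.map Prod.snd = ν

/-- The `1`-Wasserstein distance: the infimum of the transportation cost over all couplings. -/
def W1 {X : Type*} [MeasurableSpace X] [PseudoEMetricSpace X] (μ ν : Measure X) : ℝ≥0∞ :=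
  ⨅ (π : Measure (X × X)) (_ : IsCouplingOf π μ ν), ∫⁻ p, edist p.1 p.2 ∂π

/-- The utility loss: the maximum, over all sets `S` of `s` coordinates, of the
`1`-Wasserstein distance between the marginals of `μ` and `ν` on the coordinates in `S`. -/
def utilityLoss {d : ℕ} (s : ℕ) (μ ν : Measure (Cube d)) : ℝ≥0∞ :=
  ⨆ (S : Finset (Fin d)) (_ : S.card = s), W1 (μ.map (coordProj S)) (ν.map (coordProj S))

/-- The empirical measure `μ_D` of a data set `D` of size `n`. -/
def empiricalMeasure {d n : ℕ} (D : Fin n → Cube d) : Measure (Cube d) :=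
  (n : ℝ≥0∞)⁻¹ • ∑ i, Measure.dirac (D i)

/-- A randomized algorithm that takes a data set of size `n` in `[0,1]^d` and returns a random
probability measure on `[0,1]^d`, given by the law of its output on each data set. -/
abbrev RandomizedAlgorithm (d n : ℕ) : Type :=
  (Fin n → Cube d) → ProbabilityMeasure (ProbabilityMeasure (Cube d))

/-- The two data sets differ in (at most) a single entry. -/
def DifferInOneEntry {d n : ℕ} (D D' : Fin n → Cube d) : Prop :=
  ∃ i, ∀ j, j ≠ i → D j = D' j

/-- `ε`-differential privacy. -/
def IsDP {d n : ℕ} (ε : ℝ) (A : RandomizedAlgorithm d n) : Prop :=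
  ∀ D D' : Fin n → Cube d, DifferInOneEntry D D' →
    ∀ E : Set (ProbabilityMeasure (Cube d)), MeasurableSet E →
      (A D : Measure (ProbabilityMeasure (Cube d))) E ≤
        ENNReal.ofReal (Real.exp ε) * (A D' : Measure (ProbabilityMeasure (Cube d))) E

/-- The output of the algorithm is almost surely supported on finitely many points. -/
def HasFinitelySupportedOutput {d n : ℕ} (A : RandomizedAlgorithm d n) : Prop :=
  ∀ D : Fin n → Cube d, ∀ᵐ (ν : ProbabilityMeasure (Cube d)) ∂(A D : Measure (ProbabilityMeasure (Cube d))),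
    ∃ F : Finset (Cube d), (ν : Measure (Cube d)) ((F : Set (Cube d))ᶜ) = 0

/-- The expected utility loss of the algorithm on the data set `D`. -/
def expectedUtilityLoss {d n : ℕ} (s : ℕ) (A : RandomizedAlgorithm d n)
    (D : Fin n → Cube d) : ℝ≥0∞ :=
  ∫⁻ (ν : ProbabilityMeasure (Cube d)), utilityLoss s (empiricalMeasure D) (ν : Measure (Cube d))
    ∂(A D : Measure (ProbabilityMeasure (Cube d)))

end

/-!
**Upper bound.** Cut each cube `[0,1]^S`, `|S| = s`, into `K = g ^ s` cells and enumerate them along a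
snake path (`snake`), so that two points whose positions differ by `p` are at distance at most
`(p + 1) / g`. Matching two data sets in sorted order along the path then bounds the `W₁`
distance of their `S`-marginals by the `ℓ₁` distance of the distribution functions of the positions
(`W1_marginal_le`), whatever `s` is.

The distribution functions are released through dyadic trees with `L ≈ log₂ K` levels: a data point
changes at most one label per level, and a value of the distribution function is a sum of one label
per level (`prefixSum_treeStat`). With independent Laplace labels of scale `L N / ε`, where `N` is the
number of sets `S`, a prefix sum has standard deviation of order `L^{3/2} N / ε`, because the errors of
the levels cancel. The loss, however, is a maximum over all `S`, and its mean under independent noise is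
larger by logarithmic factors. The noise is therefore tilted by the factor `exp (-b R)`, `R` being the
maximal loss itself (`noiseLaw`). This costs little privacy, since one data point moves `R` by at most
`K`. And it removes the maximum: by Markov's inequality and independence all `N` losses are small
simultaneously with probability at least `2^{-N}`, and tilting turns this into the bound
`E R ≲ K L^{3/2} N / ε` (`lintegral_tilted_neg_le`, `lintegral_maxLoss_noiseLaw_le`). The output is the
empirical measure of a data set that fits the noisy labels best (`reconstruct`); labels are integers,
so a best fit exists and everything lives on a countable probability space. The choice
`K ≈ nε / (d^s log^{3/2} (nε))` gives the rate (`grid_choice_bound`).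

**Lower bound.** Consider all data sets with entries in a grid of `g ^ s ≥ B n` points, `B` depending
on `ε`. A fixed output `ν` has at most `2 n` heavy grid points, those near which it has mass at least
`1 / (2 n)`. If most entries of a data set are at light points, its loss is at least `1 / (8 g)`
(`le_W1_of_light`), and only a fraction `(exp (-ε) / 4) ^ n` of all data sets have half of their
entries at heavy points (`card_heavyEvent_le`). By group privacy (`IsDP.le_exp_pow_mul`), if all data
sets were served well, then a random data set would be served well by the output for one fixed data set
with probability at least `exp (-ε n) / 2`, a contradiction (`exists_le_expectedUtilityLoss`).
-/

noncomputable section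

/-! ### Wasserstein distance of empirical measures -/

instance empiricalMeasure.isProbabilityMeasure {d n : ℕ} [NeZero n] (D : Fin n → Cube d) :
    IsProbabilityMeasure (empiricalMeasure D) := by
  constructor
  simp [empiricalMeasure, ENNReal.inv_mul_cancel, NeZero.ne n]

lemma map_empiricalMeasure {d n : ℕ} {X : Type*} [MeasurableSpace X] {f : Cube d → X}
    (hf : Measurable f) (D : Fin n → Cube d) :
    (empiricalMeasure D).map f = (n : ℝ≥0∞)⁻¹ • ∑ i, Measure.dirac (f (D i)) := by
  rw [empiricalMeasure, Measure.map_smul, Measure.map_finset_sum' hf.aemeasurable]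
  simp [Measure.map_dirac' hf]

lemma measurable_coordProj {d : ℕ} (S : Finset (Fin d)) : Measurable (coordProj S) :=
  measurable_pi_lambda _ fun i => measurable_pi_apply (i : Fin d)

lemma W1_empirical_le_matching {X : Type*} [MeasurableSpace X] [PseudoEMetricSpace X]
    [MeasurableSingletonClass X] {n : ℕ} (x y : Fin n → X) (σ : Equiv.Perm (Fin n)) :
    W1 ((n : ℝ≥0∞)⁻¹ • ∑ i, Measure.dirac (x i)) ((n : ℝ≥0∞)⁻¹ • ∑ i, Measure.dirac (y i)) ≤
      (n : ℝ≥0∞)⁻¹ * ∑ i, edist (x i) (y (σ i)) := by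
  refine (iInf₂_le ((n : ℝ≥0∞)⁻¹ • ∑ i, Measure.dirac (x i, y (σ i))) ⟨?_, ?_⟩).trans ?_
  · rw [lintegral_smul_measure, lintegral_finsetSum_measure]
    simp
  · rw [Measure.map_smul, Measure.map_finset_sum' measurable_fst.aemeasurable]
    simp [Measure.map_dirac' measurable_fst]
  · rw [Measure.map_smul, Measure.map_finset_sum' measurable_snd.aemeasurable]
    simp only [Measure.map_dirac' measurable_snd]
    rw [Equiv.sum_comp σ fun i => Measure.dirac (y i)]

/-- The number of entries of `u` below `k`. -/
def countBelow {n : ℕ} (u : Fin n → ℕ) (k : ℕ) : ℕ := ∑ i, if u i < k then 1 else 0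

lemma countBelow_comp_perm {n : ℕ} (u : Fin n → ℕ) (σ : Equiv.Perm (Fin n)) (k : ℕ) :
    countBelow (u ∘ σ) k = countBelow u k :=
  Equiv.sum_comp σ fun i => if u i < k then 1 else 0

lemma abs_sub_eq_sum_threshold {K a b : ℕ} (ha : a < K) (hb : b < K) :
    |(a : ℤ) - b| = ∑ k ∈ Finset.range K,
      |(if a < k then 1 else 0 : ℤ) - (if b < k then 1 else 0)| := by
  wlog h : a ≤ b generalizing a b
  · rw [abs_sub_comm, this hb ha (by omega)]
    exact Finset.sum_congr rfl fun k _ => abs_sub_comm _ _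
  have : ∀ k ∈ Finset.range K, |(if a < k then 1 else 0 : ℤ) - (if b < k then 1 else 0)| =
      if k ∈ Finset.Ioc a b then 1 else 0 := by
    intro k _
    simp only [Finset.mem_Ioc]
    split_ifs <;> first | omega | simp
  rw [Finset.sum_congr rfl this, Finset.sum_ite_mem, Finset.inter_eq_right.mpr]
  · simp only [Finset.sum_const, Nat.card_Ioc, nsmul_eq_mul, mul_one]
    rw [abs_of_nonpos (by omega)]
    omega
  · intro k hk
    simp only [Finset.mem_Ioc, Finset.mem_range] at *
    omega

/-- For monotone sequences the sets of indices below a threshold are nested, so no cancellation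
takes place in the difference of the two counts. -/
lemma sum_abs_threshold_of_monotone {n : ℕ} {u v : Fin n → ℕ} (hu : Monotone u) (hv : Monotone v)
    (k : ℕ) :
    ∑ i, |(if u i < k then 1 else 0 : ℤ) - (if v i < k then 1 else 0)| =
      |(countBelow u k : ℤ) - countBelow v k| := by
  have lower : ∀ {w : Fin n → ℕ}, Monotone w → IsLowerSet {i | w i < k} :=
    fun hw i j hji hi => (hw hji).trans_lt hi
  wlog h : {i | u i < k} ⊆ {i | v i < k} generalizing u v
  · rw [abs_sub_comm, ← this hv hu (((lower hu).total (lower hv)).resolve_left h)]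
    exact Finset.sum_congr rfl fun k _ => abs_sub_comm _ _
  have key : ∀ i, (if u i < k then 1 else 0 : ℤ) ≤ (if v i < k then 1 else 0) := by
    intro i
    have := @h i
    simp only [Set.mem_ofPred_eq] at this
    split_ifs <;> simp_all
  have key2 : (countBelow u k : ℤ) ≤ countBelow v k := by
    simp only [countBelow]
    push_cast
    exact Finset.sum_le_sum fun i _ => key i
  rw [abs_of_nonpos (sub_nonpos.mpr key2)]
  simp only [countBelow]
  push_cast
  rw [neg_sub, ← Finset.sum_sub_distrib]
  refine Finset.sum_congr rfl fun i _ => ?_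
  rw [abs_of_nonpos (sub_nonpos.mpr (key i)), neg_sub]

/-- One-dimensional transport: matching two integer samples in sorted order costs exactly the
`ℓ₁` distance of their distribution functions. -/
lemma exists_perm_sum_abs_sub_eq {n K : ℕ} {u v : Fin n → ℕ} (hu : ∀ i, u i < K)
    (hv : ∀ i, v i < K) :
    ∃ σ : Equiv.Perm (Fin n), ∑ i, |(u i : ℤ) - v (σ i)| =
      ∑ k ∈ Finset.range K, |(countBelow u k : ℤ) - countBelow v k| := by
  refine ⟨(Tuple.sort u).symm.trans (Tuple.sort v), ?_⟩
  rw [← Equiv.sum_comp (Tuple.sort u)]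
  simp only [Equiv.trans_apply, Equiv.symm_apply_apply]
  rw [Finset.sum_congr rfl fun i _ => abs_sub_eq_sum_threshold (hu _) (hv _), Finset.sum_comm]
  refine Finset.sum_congr rfl fun k _ => ?_
  rw [← countBelow_comp_perm u (Tuple.sort u), ← countBelow_comp_perm v (Tuple.sort v)]
  exact sum_abs_threshold_of_monotone (Tuple.monotone_sort u) (Tuple.monotone_sort v) k

/-! ### The snake enumeration of grid cells -/

/-- The position of the cell with coordinates `a 0, …, a (r - 1) ∈ {0, …, g - 1}` on a snake path
through the grid: each new coordinate runs alternately upwards and downwards, so that consecutive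
cells on the path are neighbours. -/
def snake (g : ℕ) : ℕ → (ℕ → ℕ) → ℕ
  | 0, _ => 0
  | r + 1, a => snake g r a * g + if Even (snake g r a) then a r else g - 1 - a r

lemma snake_lt_pow {g : ℕ} {a : ℕ → ℕ} (ha : ∀ i, a i < g) (r : ℕ) : snake g r a < g ^ r := by
  induction r with
  | zero => simp [snake]
  | succ r ih =>
    have h1 : (if Even (snake g r a) then a r else g - 1 - a r) < g := by
      have := ha r
      split_ifs <;> omega
    calc snake g (r + 1) a < snake g r a * g + g := by
          simp only [snake]; omega
      _ = (snake g r a + 1) * g := by ring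
      _ ≤ g ^ r * g := Nat.mul_le_mul_right g ih
      _ = g ^ (r + 1) := (pow_succ g r).symm

/-- Positions on the snake path bound the distance of the cells. -/
lemma abs_sub_le_abs_snake_sub {g : ℕ} {a b : ℕ → ℕ} (ha : ∀ i, a i < g) (hb : ∀ i, b i < g)
    (r : ℕ) : ∀ j < r, |(a j : ℤ) - b j| ≤ |(snake g r a : ℤ) - snake g r b| := by
  induction r with
  | zero => simp
  | succ r ih =>
    -- It suffices to treat the last coordinate and to show that positions move apart.
    suffices h : |(a r : ℤ) - b r| ≤ |(snake g (r + 1) a : ℤ) - snake g (r + 1) b| ∧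
        |(snake g r a : ℤ) - snake g r b| ≤ |(snake g (r + 1) a : ℤ) - snake g (r + 1) b| by
      intro j hj
      rcases Nat.lt_succ_iff_lt_or_eq.mp hj with hj | rfl
      · exact (ih j hj).trans h.2
      · exact h.1
    clear ih
    have ha := ha r
    have hb := hb r
    simp only [snake]
    generalize snake g r a = i, snake g r b = i', a r = p, b r = q at *
    wlog hii : i ≤ i' generalizing i i' p q
    · have := this (i := i') (i' := i) (p := q) (q := p) hb ha (by omega)
      simp only [Int.abs_eq_natAbs] at this ⊢
      omega
    simp only [Int.abs_eq_natAbs]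
    obtain ⟨e, rfl⟩ := Nat.exists_eq_add_of_le hii
    rcases e with _ | _ | e
    · simp only [add_zero]
      generalize i * g = w
      split_ifs <;> constructor <;> omega
    · have hpar : Even (i + 1) ↔ ¬ Even i := Nat.even_add_one
      simp only [zero_add, hpar, add_mul, one_mul]
      generalize i * g = w
      split_ifs <;> constructor <;> omega
    · have h1 : (i + (e + 1 + 1)) * g = i * g + e * g + 2 * g := by ring
      have h2 : e ≤ e * g := Nat.le_mul_of_pos_right e (by omega)
      rw [h1]
      generalize i * g = w, e * g = w' at *
      split_ifs <;> constructor <;> omega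

/-- The index of the cell of width `1 / g` containing `t`; the last cell is closed. -/
def gridCoord (g : ℕ) (t : unitInterval) : ℕ := min (g - 1) ⌊(g : ℝ) * t⌋₊

lemma gridCoord_lt {g : ℕ} (hg : 0 < g) (t : unitInterval) : gridCoord g t < g := by
  unfold gridCoord; omega

lemma gridCoord_bounds {g : ℕ} (hg : 0 < g) (t : unitInterval) :
    (gridCoord g t : ℝ) ≤ g * t ∧ (g : ℝ) * t ≤ gridCoord g t + 1 := by
  have h0 : 0 ≤ (g : ℝ) * t := mul_nonneg (by positivity) t.2.1
  have h1 : (g : ℝ) * t ≤ g := mul_le_of_le_one_right (by positivity) t.2.2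
  unfold gridCoord
  rcases le_total (g - 1) ⌊(g : ℝ) * t⌋₊ with h | h
  · rw [min_eq_left h]
    have h2 : ((g - 1 : ℕ) : ℝ) = g - 1 := by push_cast [Nat.cast_sub hg]; ring
    refine ⟨le_trans (Nat.cast_le.mpr h) (Nat.floor_le h0), ?_⟩
    rw [h2]; linarith
  · rw [min_eq_right h]
    exact ⟨Nat.floor_le h0, (Nat.lt_floor_add_one _).le⟩

lemma abs_sub_le_gridCoord {g : ℕ} (hg : 0 < g) (t t' : unitInterval) :
    |(t : ℝ) - t'| ≤ (|(gridCoord g t : ℤ) - gridCoord g t'| + 1 : ℤ) / (g : ℝ) := by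
  have h1 := gridCoord_bounds hg t
  have h2 := gridCoord_bounds hg t'
  have hg' : (0 : ℝ) < g := by exact_mod_cast hg
  have h : |(t : ℝ) - t'| * g = |((t : ℝ) - t') * g| := by rw [abs_mul, abs_of_pos hg']
  rw [le_div_iff₀ hg', h]
  push_cast
  rw [abs_le]
  have h3 := le_abs_self ((gridCoord g t : ℝ) - gridCoord g t')
  have h4 := neg_abs_le ((gridCoord g t : ℝ) - gridCoord g t')
  constructor <;> linarith

/-- The position on the snake path of the cell of `[0,1]^S` containing the projection of `x`. -/
def cellIndex {d : ℕ} (g : ℕ) (S : Finset (Fin d)) (x : Cube d) : ℕ :=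
  snake g S.card fun r =>
    if h : r < S.card then gridCoord g (x (S.equivFin.symm ⟨r, h⟩)) else 0

lemma cellIndex_lt {d g : ℕ} (hg : 0 < g) (S : Finset (Fin d)) (x : Cube d) :
    cellIndex g S x < g ^ S.card := by
  refine snake_lt_pow (fun i => ?_) _
  split_ifs
  · exact gridCoord_lt hg _
  · exact hg

lemma dist_coordProj_le {d g : ℕ} (hg : 0 < g) (S : Finset (Fin d)) (x y : Cube d) :
    dist (coordProj S x) (coordProj S y) ≤
      (|(cellIndex g S x : ℤ) - cellIndex g S y| + 1 : ℤ) / (g : ℝ) := by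
  refine (dist_pi_le_iff (by positivity)).mpr fun i => ?_
  rw [Subtype.dist_eq, Real.dist_eq]
  refine (abs_sub_le_gridCoord hg _ _).trans ?_
  gcongr ((?_ + 1 : ℤ) : ℝ) / _
  have key := abs_sub_le_abs_snake_sub (g := g)
    (a := fun r => if h : r < S.card then gridCoord g (x (S.equivFin.symm ⟨r, h⟩)) else 0)
    (b := fun r => if h : r < S.card then gridCoord g (y (S.equivFin.symm ⟨r, h⟩)) else 0)
    (fun r => by split_ifs; exacts [gridCoord_lt hg _, hg])
    (fun r => by split_ifs; exacts [gridCoord_lt hg _, hg])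
    S.card (S.equivFin i) (S.equivFin i).2
  simp only [Fin.eta, Fin.is_lt, dite_true, Equiv.symm_apply_apply] at key
  exact key

/-- The distance of the distribution functions along the snake path of the `S`-marginals of two
data sets. -/
def cellMisfit {d n : ℕ} (g : ℕ) (S : Finset (Fin d)) (D D' : Fin n → Cube d) : ℤ :=
  ∑ k ∈ Finset.range (g ^ S.card),
    |(countBelow (fun i => cellIndex g S (D i)) k : ℤ) - countBelow (fun i => cellIndex g S (D' i)) k|

lemma W1_marginal_le {d n g : ℕ} (hg : 0 < g) (hn : 0 < n) (S : Finset (Fin d))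
    (D D' : Fin n → Cube d) :
    W1 ((empiricalMeasure D).map (coordProj S)) ((empiricalMeasure D').map (coordProj S)) ≤
      ENNReal.ofReal ((cellMisfit g S D D' / n + 1) / g) := by
  rw [map_empiricalMeasure (measurable_coordProj S), map_empiricalMeasure (measurable_coordProj S)]
  obtain ⟨σ, hσ⟩ := exists_perm_sum_abs_sub_eq (fun i => cellIndex_lt hg S (D i))
    (fun i => cellIndex_lt hg S (D' i))
  refine (W1_empirical_le_matching _ _ σ).trans ?_
  have hn' : (0 : ℝ) < n := by exact_mod_cast hn
  rw [← ENNReal.ofReal_natCast, ← ENNReal.ofReal_inv_of_pos hn']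
  simp only [edist_dist]
  rw [← ENNReal.ofReal_sum_of_nonneg fun _ _ => dist_nonneg, ← ENNReal.ofReal_mul (by positivity)]
  refine ENNReal.ofReal_le_ofReal ?_
  calc (n : ℝ)⁻¹ * ∑ i, dist (coordProj S (D i)) (coordProj S (D' (σ i)))
      ≤ (n : ℝ)⁻¹ * ∑ i, (|(cellIndex g S (D i) : ℤ) - cellIndex g S (D' (σ i))| + 1 : ℤ) / (g : ℝ) := by
        gcongr
        exact dist_coordProj_le hg S _ _
    _ = (cellMisfit g S D D' / n + 1) / g := by
        rw [← Finset.sum_div, ← Int.cast_sum, Finset.sum_add_distrib, hσ]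
        simp only [cellMisfit, Finset.sum_const, Finset.card_univ, Fintype.card_fin]
        push_cast
        simp only [nsmul_eq_mul, mul_one, Int.cast_natCast]
        field_simp

/-! ### The discrete Laplace distribution -/

lemma tilted_singleton {α : Type*} [MeasurableSpace α] [MeasurableSingletonClass α]
    (μ : Measure α) (f : α → ℝ) (x : α) :
    μ.tilted f {x} = ENNReal.ofReal (Real.exp (f x) / ∫ y, Real.exp (f y) ∂μ) * μ {x} := by
  rw [tilted_apply' μ f (measurableSet_singleton x), lintegral_singleton]

/-- The probability measure on `ℤ` with weights proportional to `exp (-a |z|)`. -/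
def discreteLaplace (a : ℝ) : Measure ℤ :=
  Measure.count.tilted fun z => -(a * |(z : ℝ)|)

lemma hasSum_exp_neg_mul_abs {a : ℝ} (ha : 0 < a) :
    HasSum (fun z : ℤ => Real.exp (-(a * |(z : ℝ)|)))
      ((1 + Real.exp (-a)) / (1 - Real.exp (-a))) := by
  set r := Real.exp (-a) with hr
  have hr1 : r < 1 := Real.exp_lt_one_iff.mpr (by linarith)
  have hr0 : 0 ≤ r := (Real.exp_pos _).le
  have hpow : ∀ m : ℕ, Real.exp (-(a * m)) = r ^ m := fun m => by
    rw [hr, ← Real.exp_nat_mul]; congr 1; ring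
  have h1 : HasSum (fun n : ℕ => Real.exp (-(a * |((n : ℤ) : ℝ)|))) (1 - r)⁻¹ := by
    simpa [hpow] using hasSum_geometric_of_lt_one hr0 hr1
  have h2 : HasSum (fun n : ℕ => Real.exp (-(a * |((-(n + 1 : ℤ) : ℤ) : ℝ)|))) (r * (1 - r)⁻¹) := by
    have e : (fun n : ℕ => Real.exp (-(a * |((-(n + 1 : ℤ) : ℤ) : ℝ)|))) = fun n => r * r ^ n := by
      ext n
      rw [← pow_succ', ← hpow]
      push_cast
      rw [abs_neg, abs_of_nonneg (by positivity)]
    rw [e]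
    exact (hasSum_geometric_of_lt_one hr0 hr1).mul_left r
  have e : (1 + r) / (1 - r) = (1 - r)⁻¹ + r * (1 - r)⁻¹ := by rw [div_eq_mul_inv]; ring
  rw [e]
  exact HasSum.of_nat_of_neg_add_one (f := fun z : ℤ => Real.exp (-(a * |(z : ℝ)|))) h1 h2

lemma integrable_count_exp_neg_mul_abs {a : ℝ} (ha : 0 < a) :
    Integrable (fun z : ℤ => Real.exp (-(a * |(z : ℝ)|))) Measure.count :=
  integrable_count_iff.mpr (hasSum_exp_neg_mul_abs ha).summable.abs

lemma integral_count_exp_neg_mul_abs {a : ℝ} (ha : 0 < a) :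
    ∫ z : ℤ, Real.exp (-(a * |(z : ℝ)|)) ∂Measure.count =
      (1 + Real.exp (-a)) / (1 - Real.exp (-a)) := by
  rw [integral_countable (integrable_count_exp_neg_mul_abs ha)]
  simpa [Measure.real] using (hasSum_exp_neg_mul_abs ha).tsum_eq

lemma isProbabilityMeasure_discreteLaplace {a : ℝ} (ha : 0 < a) :
    IsProbabilityMeasure (discreteLaplace a) :=
  isProbabilityMeasure_tilted (integrable_count_exp_neg_mul_abs ha)

/-- Halving the rate at most doubles the normalizing constant. -/
lemma integral_count_exp_half_le {a : ℝ} (ha : 0 < a) :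
    ∫ z : ℤ, Real.exp (-(a / 2 * |(z : ℝ)|)) ∂Measure.count ≤
      2 * ∫ z : ℤ, Real.exp (-(a * |(z : ℝ)|)) ∂Measure.count := by
  rw [integral_count_exp_neg_mul_abs ha, integral_count_exp_neg_mul_abs (half_pos ha)]
  have hsq : Real.exp (-a) = Real.exp (-(a / 2)) ^ 2 := by
    rw [← Real.exp_nat_mul]; congr 1; push_cast; ring
  rw [hsq]
  have hr1 : Real.exp (-(a / 2)) < 1 := Real.exp_lt_one_iff.mpr (by linarith)
  have hr0 : 0 < Real.exp (-(a / 2)) := Real.exp_pos _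
  generalize Real.exp (-(a / 2)) = r at *
  have h3 : 1 - r ^ 2 = (1 - r) * (1 + r) := by ring
  have h4 : 0 < 1 - r := by linarith
  rw [h3, ← mul_div_assoc, div_le_div_iff₀ h4 (by positivity)]
  nlinarith [mul_nonneg h4.le (sq_nonneg (1 - r))]

lemma sq_mul_exp_le {a : ℝ} (ha : 0 < a) (z : ℤ) :
    Real.exp (-(a * |(z : ℝ)|)) * (z : ℝ) ^ 2 ≤ 8 / a ^ 2 * Real.exp (-(a / 2 * |(z : ℝ)|)) := by
  have h := Real.quadratic_le_exp_of_nonneg (x := a / 2 * |(z : ℝ)|) (by positivity)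
  have h0 : 0 ≤ a / 2 * |(z : ℝ)| := by positivity
  have hz : (z : ℝ) ^ 2 ≤ 8 / a ^ 2 * Real.exp (a / 2 * |(z : ℝ)|) := by
    rw [div_mul_eq_mul_div, le_div_iff₀ (by positivity), ← sq_abs]
    nlinarith
  calc Real.exp (-(a * |(z : ℝ)|)) * (z : ℝ) ^ 2
      ≤ Real.exp (-(a * |(z : ℝ)|)) * (8 / a ^ 2 * Real.exp (a / 2 * |(z : ℝ)|)) := by gcongr
    _ = 8 / a ^ 2 * (Real.exp (-(a * |(z : ℝ)|)) * Real.exp (a / 2 * |(z : ℝ)|)) := by ring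
    _ = 8 / a ^ 2 * Real.exp (-(a / 2 * |(z : ℝ)|)) := by
        rw [← Real.exp_add]; congr 2; ring

lemma integrable_sq_discreteLaplace {a : ℝ} (ha : 0 < a) :
    Integrable (fun z : ℤ => (z : ℝ) ^ 2) (discreteLaplace a) := by
  rw [discreteLaplace, integrable_tilted_iff (f := fun z : ℤ => -(a * |(z : ℝ)|))
    (integrable_count_exp_neg_mul_abs ha)]
  refine ((integrable_count_exp_neg_mul_abs (half_pos ha)).const_mul (8 / a ^ 2)).mono'
    (by fun_prop) (.of_forall fun z => ?_)
  rw [smul_eq_mul, Real.norm_of_nonneg (by positivity)]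
  exact sq_mul_exp_le ha z

lemma integral_sq_discreteLaplace_le {a : ℝ} (ha : 0 < a) :
    ∫ z : ℤ, (z : ℝ) ^ 2 ∂discreteLaplace a ≤ 16 / a ^ 2 := by
  have hpos : 0 < ∫ z : ℤ, Real.exp (-(a * |(z : ℝ)|)) ∂Measure.count :=
    integral_exp_pos (integrable_count_exp_neg_mul_abs ha)
  have hint := (integrable_count_exp_neg_mul_abs (half_pos ha)).const_mul (8 / a ^ 2)
  rw [discreteLaplace, integral_tilted]
  simp only [smul_eq_mul, div_mul_eq_mul_div]
  rw [integral_div, div_le_iff₀ hpos]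
  calc ∫ z : ℤ, Real.exp (-(a * |(z : ℝ)|)) * (z : ℝ) ^ 2 ∂Measure.count
      ≤ ∫ z : ℤ, 8 / a ^ 2 * Real.exp (-(a / 2 * |(z : ℝ)|)) ∂Measure.count :=
        integral_mono_of_nonneg (.of_forall fun z => by positivity) hint
          (.of_forall fun z => sq_mul_exp_le ha z)
    _ ≤ 8 / a ^ 2 * (2 * ∫ z : ℤ, Real.exp (-(a * |(z : ℝ)|)) ∂Measure.count) := by
        rw [integral_const_mul]
        gcongr
        exact integral_count_exp_half_le ha
    _ = _ := by ring

lemma integral_discreteLaplace (a : ℝ) : ∫ z : ℤ, (z : ℝ) ∂discreteLaplace a = 0 := by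
  have hmap : (discreteLaplace a).map Neg.neg = discreteLaplace a := by
    refine Measure.ext_of_singleton fun z => ?_
    rw [Measure.map_apply measurable_neg (measurableSet_singleton z), Set.neg_preimage, Set.neg_singleton,
      discreteLaplace, tilted_singleton, tilted_singleton]
    simp
  have h : ∫ z : ℤ, (z : ℝ) ∂discreteLaplace a = -∫ z : ℤ, (z : ℝ) ∂discreteLaplace a := by
    conv_lhs => rw [← hmap, integral_map measurable_neg.aemeasurable (by fun_prop)]
    simp [integral_neg]
  linarith

lemma memLp_discreteLaplace {a : ℝ} (ha : 0 < a) :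
    MemLp (fun z : ℤ => (z : ℝ)) 2 (discreteLaplace a) :=
  (memLp_two_iff_integrable_sq (by fun_prop)).mpr (integrable_sq_discreteLaplace ha)

lemma discreteLaplace_singleton_le {a : ℝ} (ha : 0 < a) (z h : ℤ) :
    discreteLaplace a {z} ≤ ENNReal.ofReal (Real.exp (a * |(h : ℝ)|)) * discreteLaplace a {z + h} := by
  rw [discreteLaplace, tilted_singleton, tilted_singleton, ← mul_assoc,
    ← ENNReal.ofReal_mul (Real.exp_pos _).le, Measure.count_singleton, Measure.count_singleton,
    mul_one, mul_one, ← mul_div_assoc, ← Real.exp_add]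
  refine ENNReal.ofReal_le_ofReal ?_
  refine div_le_div_of_nonneg_right (Real.exp_le_exp.mpr ?_)
    (integral_nonneg fun z : ℤ => (Real.exp_pos _).le)
  push_cast
  linarith [mul_le_mul_of_nonneg_left (abs_add_le (z : ℝ) h) ha.le]

/-- A sum of independent centered discrete Laplace variables is of the order of the square root of
the number of summands. -/
lemma integral_abs_sum_discreteLaplace_le {a : ℝ} (ha : 0 < a) {ι κ : Type*} [Fintype ι]
    [Fintype κ] (f : κ → ι) (hf : Function.Injective f) [Nonempty κ] :
    Integrable (fun z : ι → ℤ => |∑ j, (z (f j) : ℝ)|) (Measure.pi fun _ => discreteLaplace a) ∧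
    ∫ z : ι → ℤ, |∑ j, (z (f j) : ℝ)| ∂(Measure.pi fun _ => discreteLaplace a) ≤
      4 * Real.sqrt (Fintype.card κ) / a := by
  have := isProbabilityMeasure_discreteLaplace ha
  set P : Measure (ι → ℤ) := Measure.pi fun _ => discreteLaplace a with hP
  have hmp : ∀ i, MeasurePreserving (Function.eval i) P (discreteLaplace a) :=
    measurePreserving_eval fun _ => discreteLaplace a
  have hL : ∀ i, MemLp (fun z : ι → ℤ => (z i : ℝ)) 2 P := fun i =>
    (memLp_discreteLaplace ha).comp_measurePreserving (hmp i)
  have hmean : ∀ i, ∫ z : ι → ℤ, (z i : ℝ) ∂P = 0 := fun i => by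
    rw [← integral_discreteLaplace a, ← (hmp i).map_eq,
      integral_map (hmp i).measurable.aemeasurable (by fun_prop)]
  have hsq : ∀ i, ∫ z : ι → ℤ, (z i : ℝ) ^ 2 ∂P ≤ 16 / a ^ 2 := fun i => by
    refine le_trans (le_of_eq ?_) (integral_sq_discreteLaplace_le ha)
    rw [← (hmp i).map_eq, integral_map (hmp i).measurable.aemeasurable (by fun_prop)]
  have hind : ProbabilityTheory.iIndepFun (fun i (z : ι → ℤ) => (z i : ℝ)) P :=
    ProbabilityTheory.iIndepFun_pi (X := fun _ (z : ℤ) => (z : ℝ)) fun i => by fun_prop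
  have hsumL : MemLp (fun z : ι → ℤ => ∑ j, (z (f j) : ℝ)) 2 P :=
    memLp_finsetSum _ fun j _ => hL (f j)
  have hsum2 : ∫ z : ι → ℤ, (∑ j, (z (f j) : ℝ)) ^ 2 ∂P ≤ Fintype.card κ * (16 / a ^ 2) := by
    have h1 := ProbabilityTheory.IndepFun.variance_sum (s := Finset.univ)
      (X := fun (j : κ) (z : ι → ℤ) => (z (f j) : ℝ)) (fun j _ => hL (f j))
      (fun i _ j _ hij => hind.indepFun (hf.ne hij))
    have h2 : (∑ j, fun z : ι → ℤ => (z (f j) : ℝ)) = fun z => ∑ j, (z (f j) : ℝ) := by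
      ext z; simp
    rw [h2, ProbabilityTheory.variance_of_integral_eq_zero hsumL.aestronglyMeasurable.aemeasurable]
      at h1
    · rw [h1]
      refine (Finset.sum_le_card_nsmul _ _ (16 / a ^ 2) fun j _ => ?_).trans_eq (by simp)
      rw [ProbabilityTheory.variance_of_integral_eq_zero
        (hL _).aestronglyMeasurable.aemeasurable (hmean _)]
      exact hsq _
    · rw [integral_finsetSum _ fun j _ => (hL (f j)).integrable one_le_two]
      simp [hmean]
  refine ⟨(hsumL.integrable one_le_two).abs, ?_⟩
  set L : ℝ := (Fintype.card κ : ℝ) with hLdef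
  have hLpos : 0 < L := by simp [hLdef, Fintype.card_pos]
  -- The inequality `|x| ≤ (x² / t + t) / 2`, optimized at the standard deviation `t`.
  set t : ℝ := 4 * Real.sqrt L / a with ht
  have htpos : 0 < t := by positivity
  have htt : t ^ 2 = L * (16 / a ^ 2) := by
    rw [ht, div_pow, mul_pow, Real.sq_sqrt hLpos.le]; ring
  calc ∫ z : ι → ℤ, |∑ j, (z (f j) : ℝ)| ∂P
      ≤ ∫ z : ι → ℤ, ((∑ j, (z (f j) : ℝ)) ^ 2 / (2 * t) + t / 2) ∂P := by
        refine integral_mono (hsumL.integrable one_le_two).abs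
          ((hsumL.integrable_sq.div_const _).add (integrable_const _)) fun z => ?_
        have := sq_nonneg (|∑ j, (z (f j) : ℝ)| - t)
        rw [← sub_nonneg, ← sq_abs]
        have h3 : ∀ x : ℝ, x ^ 2 / (2 * t) + t / 2 - x = (x - t) ^ 2 / (2 * t) := fun x => by
          field_simp; ring
        rw [h3]
        positivity
    _ = (∫ z : ι → ℤ, (∑ j, (z (f j) : ℝ)) ^ 2 ∂P) / (2 * t) + t / 2 := by
        rw [integral_add (hsumL.integrable_sq.div_const _) (integrable_const _), integral_div]
        simp
    _ ≤ t ^ 2 / (2 * t) + t / 2 := by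
        rw [htt]; gcongr
    _ = t := by field_simp; ring

/-! ### Tilting a measure towards small values -/

/-- Let `R ≤ ρ` with probability at least `exp (-N)`. Tilting the measure by `exp (-b R)` makes
this event likely: the mean of `R` drops to at most `ρ + (N + 1) / b`. -/
lemma lintegral_tilted_neg_le {Y : Type*} [MeasurableSpace Y] (P : Measure Y)
    [IsProbabilityMeasure P] {R : Y → ℝ} (hR : Measurable R) (hR0 : ∀ y, 0 ≤ R y) {b ρ N : ℝ}
    (hb : 0 < b) (hN : 0 ≤ N) (hρ : 0 ≤ ρ) (hP : Real.exp (-N) ≤ P.real {y | R y ≤ ρ}) :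
    ∫⁻ y, ENNReal.ofReal (R y) ∂(P.tilted fun y => -(b * R y)) ≤
      ENNReal.ofReal (ρ + (N + 1) / b) := by
  have hexp : Integrable (fun y => Real.exp (-(b * R y))) P := by
    refine (integrable_const (1 : ℝ)).mono' (by fun_prop) (.of_forall fun y => ?_)
    rw [Real.norm_of_nonneg (Real.exp_pos _).le, Real.exp_le_one_iff]
    have := mul_nonneg hb.le (hR0 y)
    linarith
  set Z := ∫ y, Real.exp (-(b * R y)) ∂P with hZ
  have hZpos : 0 < Z := integral_exp_pos hexp
  set t := ρ + N / b with ht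
  have ht0 : 0 ≤ t := by positivity
  have hZlow : Real.exp (-(b * t)) ≤ Z := by
    calc Real.exp (-(b * t)) = Real.exp (-(b * ρ)) * Real.exp (-N) := by
          rw [← Real.exp_add]; congr 1; rw [ht]; field_simp; ring
      _ ≤ Real.exp (-(b * ρ)) * P.real {y | Real.exp (-(b * ρ)) ≤ Real.exp (-(b * R y))} := by
          gcongr
          refine hP.trans (measureReal_mono fun y hy => ?_)
          simp only [Set.mem_ofPred_eq, Real.exp_le_exp] at *
          nlinarith
      _ ≤ Z := mul_meas_ge_le_integral_of_nonneg (.of_forall fun y => (Real.exp_pos _).le) hexp _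
  have hpt : ∀ y, Real.exp (-(b * R y)) * R y ≤
      t * Real.exp (-(b * R y)) + Real.exp (-(b * t)) / b := by
    intro y
    have h1 := Real.add_one_le_exp (b * (R y - t))
    have h2 : Real.exp (-(b * t)) = Real.exp (-(b * R y)) * Real.exp (b * (R y - t)) := by
      rw [← Real.exp_add]; congr 1; ring
    have h3 : R y ≤ t + Real.exp (b * (R y - t)) / b := by
      rw [← sub_le_iff_le_add', le_div_iff₀ hb]; linarith
    calc Real.exp (-(b * R y)) * R y
        ≤ Real.exp (-(b * R y)) * (t + Real.exp (b * (R y - t)) / b) := by gcongr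
      _ = _ := by rw [h2]; ring
  have hmul : ∀ y, ENNReal.ofReal (Real.exp (-(b * R y)) / Z) * ENNReal.ofReal (R y) =
      ENNReal.ofReal (Real.exp (-(b * R y)) / Z * R y) := fun y =>
    (ENNReal.ofReal_mul (div_nonneg (Real.exp_pos _).le hZpos.le)).symm
  rw [lintegral_tilted, lintegral_congr hmul]
  calc ∫⁻ y, ENNReal.ofReal (Real.exp (-(b * R y)) / Z * R y) ∂P
      ≤ ∫⁻ y, ENNReal.ofReal ((t * Real.exp (-(b * R y)) + Real.exp (-(b * t)) / b) / Z) ∂P := by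
        refine lintegral_mono fun y => ENNReal.ofReal_le_ofReal ?_
        rw [div_mul_eq_mul_div]
        gcongr
        exact hpt y
    _ = ENNReal.ofReal (∫ y, (t * Real.exp (-(b * R y)) + Real.exp (-(b * t)) / b) / Z ∂P) := by
        rw [ofReal_integral_eq_lintegral_ofReal]
        · exact ((hexp.const_mul t).add (integrable_const _)).div_const Z
        · exact .of_forall fun y => by positivity
    _ ≤ ENNReal.ofReal (ρ + (N + 1) / b) := by
        refine ENNReal.ofReal_le_ofReal ?_
        rw [integral_div, integral_add (hexp.const_mul t) (integrable_const _), integral_const_mul,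
          ← hZ, div_le_iff₀ hZpos]
        simp only [integral_const, probReal_univ, one_smul]
        calc t * Z + Real.exp (-(b * t)) / b ≤ t * Z + Z / b := by gcongr
          _ = (ρ + (N + 1) / b) * Z := by rw [ht]; ring

/-! ### Dyadic prefix sums -/

/-- Integer labels of the nodes `(j, a)` of a dyadic tree with `L` levels over `{0, …, K - 1}`. -/
abbrev TreeVec (L K : ℕ) : Type := Fin L × Fin K → ℤ

/-- The node at level `j` above the leaf `k`. -/
def treeNode {L K : ℕ} (k : Fin K) (j : Fin L) : Fin L × Fin K :=
  (j, ⟨k / 2 ^ (j : ℕ), (Nat.div_le_self _ _).trans_lt k.2⟩)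

/-- The sum of the labels above the leaf `k`. -/
def prefixSum {L K : ℕ} (z : TreeVec L K) (k : Fin K) : ℤ := ∑ j, z (treeNode k j)

/-- The `ℓ₁` norm of the sequence of prefix sums. -/
def treeLoss {L K : ℕ} (z : TreeVec L K) : ℕ := ∑ k, (prefixSum z k).natAbs

/-- The worst `treeLoss` in a family of trees. -/
def maxLoss {σ : Type*} [Fintype σ] {L K : ℕ} (z : σ → TreeVec L K) : ℕ :=
  Finset.univ.sup fun S => treeLoss (z S)

lemma treeNode_injective {L K : ℕ} (k : Fin K) :
    Function.Injective (treeNode k : Fin L → Fin L × Fin K) :=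
  fun _ _ h => congrArg Prod.fst h

lemma prefixSum_add {L K : ℕ} (z w : TreeVec L K) (k : Fin K) :
    prefixSum (z + w) k = prefixSum z k + prefixSum w k :=
  Finset.sum_add_distrib

lemma prefixSum_neg {L K : ℕ} (z : TreeVec L K) (k : Fin K) :
    prefixSum (-z) k = -prefixSum z k :=
  Finset.sum_neg_distrib ..

lemma prefixSum_sub {L K : ℕ} (z w : TreeVec L K) (k : Fin K) :
    prefixSum (z - w) k = prefixSum z k - prefixSum w k := by
  rw [sub_eq_add_neg, prefixSum_add, prefixSum_neg, sub_eq_add_neg]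

lemma treeLoss_le_maxLoss {σ : Type*} [Fintype σ] {L K : ℕ} (z : σ → TreeVec L K) (S : σ) :
    treeLoss (z S) ≤ maxLoss z :=
  Finset.le_sup (f := fun S => treeLoss (z S)) (Finset.mem_univ S)

lemma treeLoss_add_le {L K : ℕ} (z w : TreeVec L K) :
    treeLoss (z + w) ≤ treeLoss z + treeLoss w := by
  unfold treeLoss
  rw [← Finset.sum_add_distrib]
  refine Finset.sum_le_sum fun k _ => ?_
  rw [prefixSum_add]
  exact Int.natAbs_add_le _ _

lemma maxLoss_add_le {σ : Type*} [Fintype σ] {L K : ℕ} (z w : σ → TreeVec L K) :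
    maxLoss (z + w) ≤ maxLoss z + maxLoss w :=
  Finset.sup_le fun S _ => (treeLoss_add_le (z S) (w S)).trans
    (add_le_add (treeLoss_le_maxLoss z S) (treeLoss_le_maxLoss w S))

lemma maxLoss_neg {σ : Type*} [Fintype σ] {L K : ℕ} (z : σ → TreeVec L K) :
    maxLoss (-z) = maxLoss z := by
  simp [maxLoss, treeLoss, prefixSum_neg]

/-- The contribution of a data point in the cell `u`: at each level it is counted by the right
sibling of its node, provided its node is a left child. -/
def treeStat (L K u : ℕ) : TreeVec L K := fun p =>
  if Even (u / 2 ^ (p.1 : ℕ)) ∧ (p.2 : ℕ) = u / 2 ^ (p.1 : ℕ) + 1 then 1 else 0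

lemma sum_range_dyadic (L : ℕ) : ∀ u k : ℕ, u < 2 ^ L → k < 2 ^ L →
    ∑ j ∈ Finset.range L, (if Even (u / 2 ^ j) ∧ k / 2 ^ j = u / 2 ^ j + 1 then 1 else 0 : ℤ) =
      if u < k then 1 else 0 := by
  induction L with
  | zero => intro u k hu hk; simp at hu hk; simp [hu, hk]
  | succ L ih =>
    intro u k hu hk
    have h := ih (u / 2) (k / 2) (by rw [pow_succ] at hu; omega) (by rw [pow_succ] at hk; omega)
    rw [Finset.sum_range_succ']
    simp only [pow_succ', ← Nat.div_div_eq_div_mul]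
    rw [h]
    simp only [pow_zero, Nat.div_one, Nat.even_iff]
    split_ifs <;> omega

/-- A leaf `k` is preceded by `u` exactly when one node above `k` counts `u`; this happens at the
level at which the paths of `u` and `k` separate. -/
lemma prefixSum_treeStat {L K u : ℕ} (hK : K ≤ 2 ^ L) (hu : u < K) (k : Fin K) :
    prefixSum (treeStat L K u) k = if u < k then 1 else 0 := by
  rw [← sum_range_dyadic L u k (by omega) (by omega), Finset.sum_range]
  rfl

lemma sum_treeStat_le (L K u : ℕ) : ∑ p, treeStat L K u p ≤ L := by
  rw [Fintype.sum_prod_type]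
  refine (Finset.sum_le_card_nsmul _ _ 1 fun j _ => ?_).trans_eq (by simp)
  simp only [treeStat]
  rw [Finset.sum_boole]
  exact_mod_cast Finset.card_le_one.mpr fun a ha b hb => by
    simp only [Finset.mem_filter] at ha hb
    exact Fin.ext (ha.2.2.trans hb.2.2.symm)

lemma sum_abs_treeStat_sub_le (L K u v : ℕ) :
    ∑ p, |treeStat L K u p - treeStat L K v p| ≤ 2 * L := by
  have habs : ∀ w p, |treeStat L K w p| = treeStat L K w p := fun w p =>
    abs_of_nonneg (by unfold treeStat; split_ifs <;> simp)
  calc ∑ p, |treeStat L K u p - treeStat L K v p|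
      ≤ ∑ p, (treeStat L K u p + treeStat L K v p) :=
        Finset.sum_le_sum fun p _ => (abs_sub _ _).trans_eq (by rw [habs, habs])
    _ ≤ 2 * L := by
        rw [Finset.sum_add_distrib]
        linarith [sum_treeStat_le L K u, sum_treeStat_le L K v]

lemma treeLoss_treeStat_sub_le {L K u v : ℕ} (hK : K ≤ 2 ^ L) (hu : u < K) (hv : v < K) :
    treeLoss (treeStat L K u - treeStat L K v) ≤ K := by
  refine (Finset.sum_le_card_nsmul _ _ 1 fun k _ => ?_).trans_eq (by simp)
  rw [prefixSum_sub, prefixSum_treeStat hK hu, prefixSum_treeStat hK hv]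
  split_ifs <;> simp

/-! ### The noise distribution -/

/-- Independent discrete Laplace labels on a family of trees. -/
def baseLaw (σ : Type*) [Fintype σ] (L K : ℕ) (a : ℝ) : Measure (σ → TreeVec L K) :=
  Measure.pi fun _ => Measure.pi fun _ => discreteLaplace a

/-- The noise distribution: the weight of `z` is proportional to
`exp (-a ‖z‖₁ - b (maxLoss z))`. -/
def noiseLaw (σ : Type*) [Fintype σ] (L K : ℕ) (a b : ℝ) : Measure (σ → TreeVec L K) :=
  (baseLaw σ L K a).tilted fun z => -(b * maxLoss z)

section Noise

variable {σ : Type*} [Fintype σ] {L K : ℕ} {a b : ℝ}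

lemma isProbabilityMeasure_baseLaw (ha : 0 < a) : IsProbabilityMeasure (baseLaw σ L K a) := by
  have := isProbabilityMeasure_discreteLaplace ha
  unfold baseLaw
  infer_instance

lemma isProbabilityMeasure_noiseLaw (ha : 0 < a) (hb : 0 < b) :
    IsProbabilityMeasure (noiseLaw σ L K a b) := by
  have := isProbabilityMeasure_baseLaw (σ := σ) (L := L) (K := K) ha
  refine isProbabilityMeasure_tilted ((integrable_const (1 : ℝ)).mono'
    (measurable_of_countable _).aestronglyMeasurable (.of_forall fun z => ?_))
  rw [Real.norm_of_nonneg (Real.exp_pos _).le, Real.exp_le_one_iff, neg_nonpos]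
  positivity

lemma baseLaw_singleton_le (ha : 0 < a) (z h : σ → TreeVec L K) :
    baseLaw σ L K a {z} ≤
      ENNReal.ofReal (Real.exp (a * ∑ S, ∑ p, |(h S p : ℝ)|)) * baseLaw σ L K a {z + h} := by
  have := isProbabilityMeasure_discreteLaplace ha
  simp only [baseLaw, Measure.pi_singleton, Finset.mul_sum, Real.exp_sum]
  rw [ENNReal.ofReal_prod_of_nonneg fun _ _ => by positivity, ← Finset.prod_mul_distrib]
  refine Finset.prod_le_prod' fun S _ => ?_
  rw [ENNReal.ofReal_prod_of_nonneg fun _ _ => by positivity, ← Finset.prod_mul_distrib]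
  exact Finset.prod_le_prod' fun p _ => discreteLaplace_singleton_le ha _ _

lemma noiseLaw_singleton_le (ha : 0 < a) (hb : 0 < b) (z h : σ → TreeVec L K) :
    noiseLaw σ L K a b {z} ≤
      ENNReal.ofReal (Real.exp (a * ∑ S, ∑ p, |(h S p : ℝ)| + b * maxLoss h)) *
        noiseLaw σ L K a b {z + h} := by
  rw [noiseLaw, tilted_singleton, tilted_singleton]
  set Z := ∫ y, Real.exp (-(b * (maxLoss y : ℝ))) ∂baseLaw σ L K a
  have hZ : 0 ≤ Z := integral_nonneg fun _ => (Real.exp_pos _).le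
  have h1 : Real.exp (-(b * (maxLoss z : ℝ))) / Z ≤
      Real.exp (b * maxLoss h) * (Real.exp (-(b * (maxLoss (z + h) : ℝ))) / Z) := by
    rw [← mul_div_assoc, ← Real.exp_add]
    refine div_le_div_of_nonneg_right (Real.exp_le_exp.mpr ?_) hZ
    have h2 : (maxLoss (z + h) : ℝ) ≤ maxLoss z + maxLoss h := by
      exact_mod_cast maxLoss_add_le z h
    linarith [mul_le_mul_of_nonneg_left h2 hb.le]
  refine (mul_le_mul' (ENNReal.ofReal_le_ofReal h1) (baseLaw_singleton_le ha z h)).trans_eq ?_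
  rw [Real.exp_add, ENNReal.ofReal_mul (by positivity), ENNReal.ofReal_mul (by positivity)]
  ring

/-- Shifting the noise changes probabilities by a factor controlled by the shift. -/
lemma noiseLaw_shift_le (ha : 0 < a) (hb : 0 < b) (q q' : σ → TreeVec L K)
    (E : Set (σ → TreeVec L K)) {ε : ℝ}
    (hε : a * ∑ S, ∑ p, |((q - q') S p : ℝ)| + b * maxLoss (q - q') ≤ ε) :
    noiseLaw σ L K a b {z | q + z ∈ E} ≤
      ENNReal.ofReal (Real.exp ε) * noiseLaw σ L K a b {z | q' + z ∈ E} := by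
  classical
  rw [← Measure.tsum_indicator_apply_singleton _ _ (DiscreteMeasurableSpace.forall_measurableSet _),
    ← Measure.tsum_indicator_apply_singleton _ {z | q' + z ∈ E}
      (DiscreteMeasurableSpace.forall_measurableSet _),
    ← ENNReal.tsum_mul_left]
  refine le_trans ?_ ((Equiv.addRight (q - q')).tsum_eq _).le
  refine ENNReal.tsum_le_tsum fun z => ?_
  have hz : q' + (z + (q - q')) = q + z := by abel
  simp only [Set.indicator_apply, Set.mem_ofPred_eq, Equiv.coe_addRight, hz]
  split_ifs
  · refine (noiseLaw_singleton_le ha hb z (q - q')).trans ?_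
    gcongr
  · simp

/-- For a single tree, the loss of the untilted noise is at most twice its mean with probability
at least `1 / 2`. -/
lemma half_le_measure_treeLoss_le (ha : 0 < a) (hL : 0 < L) (hK : 0 < K) :
    (1 / 2 : ℝ) ≤ (Measure.pi fun _ : Fin L × Fin K => discreteLaplace a).real
      {z : TreeVec L K | (treeLoss z : ℝ) ≤ 8 * K * Real.sqrt L / a} := by
  have := isProbabilityMeasure_discreteLaplace ha
  have : Nonempty (Fin L) := ⟨⟨0, hL⟩⟩
  set P : Measure (TreeVec L K) := Measure.pi fun _ : Fin L × Fin K => discreteLaplace a with hP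
  set ρ : ℝ := 8 * K * Real.sqrt L / a with hρ
  have hρ0 : 0 < ρ := by positivity
  have heq : ∀ z : TreeVec L K, (treeLoss z : ℝ) = ∑ k, |∑ j, (z (treeNode k j) : ℝ)| := by
    intro z
    simp [treeLoss, prefixSum, Nat.cast_natAbs]
  have hint := fun k : Fin K =>
    integral_abs_sum_discreteLaplace_le ha (treeNode k : Fin L → Fin L × Fin K)
      (treeNode_injective k)
  have hI : Integrable (fun z : TreeVec L K => (treeLoss z : ℝ)) P := by
    simp only [heq]
    exact integrable_finsetSum _ fun k _ => (hint k).1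
  have hE : ∫ z, (treeLoss z : ℝ) ∂P ≤ ρ / 2 := by
    simp only [heq]
    rw [integral_finsetSum _ fun k _ => (hint k).1]
    refine (Finset.sum_le_card_nsmul _ _ _ fun k _ => (hint k).2).trans_eq ?_
    simp [hρ]
    ring
  have hM := mul_meas_ge_le_integral_of_nonneg (.of_forall fun z => by positivity) hI ρ
  have hhalf : P.real {z | ρ ≤ (treeLoss z : ℝ)} ≤ 1 / 2 := by
    have : ρ * P.real {z | ρ ≤ (treeLoss z : ℝ)} ≤ ρ * (1 / 2) := by linarith
    exact le_of_mul_le_mul_left this hρ0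
  have hcov : (1 : ℝ) ≤ P.real {z | (treeLoss z : ℝ) ≤ ρ} + P.real {z | ρ ≤ (treeLoss z : ℝ)} := by
    rw [← probReal_univ (μ := P)]
    refine (measureReal_mono fun z _ => ?_).trans (measureReal_union_le _ _)
    exact le_total (treeLoss z : ℝ) ρ
  linarith

lemma exp_neg_card_le_baseLaw (ha : 0 < a) (hL : 0 < L) (hK : 0 < K) :
    Real.exp (-(Fintype.card σ : ℝ)) ≤
      (baseLaw σ L K a).real {z | (maxLoss z : ℝ) ≤ 8 * K * Real.sqrt L / a} := by
  have := isProbabilityMeasure_discreteLaplace ha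
  set ρ : ℝ := 8 * K * Real.sqrt L / a with hρ
  have hρ0 : 0 ≤ ρ := by positivity
  have hset : {z : σ → TreeVec L K | (maxLoss z : ℝ) ≤ ρ} =
      Set.univ.pi fun _ => {z : TreeVec L K | (treeLoss z : ℝ) ≤ ρ} := by
    ext z
    simp only [Set.mem_ofPred_eq, Set.mem_univ_pi, ← Nat.le_floor_iff hρ0, maxLoss,
      Finset.sup_le_iff, Finset.mem_univ, true_imp_iff]
  rw [hset, baseLaw, Measure.real, Measure.pi_pi, ENNReal.toReal_prod]
  have hexp : Real.exp (-1) ≤ 1 / 2 := by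
    rw [Real.exp_neg, ← one_div]
    have := Real.exp_one_gt_d9
    exact one_div_le_one_div_of_le (by norm_num) (by linarith)
  calc Real.exp (-(Fintype.card σ : ℝ)) = ∏ _S : σ, Real.exp (-1) := by
        rw [Finset.prod_const, ← Real.exp_nat_mul, Finset.card_univ, mul_neg_one]
    _ ≤ _ := by
        refine Finset.prod_le_prod (fun _ _ => (Real.exp_pos _).le) fun S _ => hexp.trans ?_
        exact half_le_measure_treeLoss_le ha hL hK

/-- The mean of the maximal loss over a family of trees. Tilting by the loss itself replaces the
concentration of measure that would be needed to bound the mean of the maximum under independent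
noise. -/
lemma lintegral_maxLoss_noiseLaw_le (ha : 0 < a) (hb : 0 < b) (hL : 0 < L) (hK : 0 < K) :
    ∫⁻ z, ENNReal.ofReal (maxLoss z) ∂noiseLaw σ L K a b ≤
      ENNReal.ofReal (8 * K * Real.sqrt L / a + (Fintype.card σ + 1) / b) := by
  have := isProbabilityMeasure_baseLaw (σ := σ) (L := L) (K := K) ha
  exact lintegral_tilted_neg_le (baseLaw σ L K a) (R := fun z => (maxLoss z : ℝ))
    (measurable_of_countable _) (fun z => by positivity) hb (by positivity) (by positivity)
    (exp_neg_card_le_baseLaw ha hL hK)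

end Noise

/-! ### Algorithms that output empirical measures -/

lemma measurable_probabilityMeasure_apply {X : Type*} [MeasurableSpace X] {B : Set X}
    (hB : MeasurableSet B) : Measurable fun ν : ProbabilityMeasure X => (ν : Measure X) B :=
  (Measure.measurable_coe hB).comp measurable_subtype_coe

lemma empiricalMeasure_compl_image_eq_zero {d n : ℕ} (D : Fin n → Cube d) :
    empiricalMeasure D (((Finset.univ.image D : Finset (Cube d)) : Set (Cube d))ᶜ) = 0 := by
  classical
  simp [empiricalMeasure]

/-- The algorithm that draws `z` from the noise distribution `Γ` and returns the empirical measure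
of the data set `F D z`. -/
def noisyAlgorithm {d n : ℕ} [NeZero n] {Y : Type*} [MeasurableSpace Y] [Countable Y]
    [DiscreteMeasurableSpace Y] (Γ : Measure Y) [IsProbabilityMeasure Γ]
    (F : (Fin n → Cube d) → Y → (Fin n → Cube d)) : RandomizedAlgorithm d n := fun D =>
  ⟨Γ.map fun z => ⟨empiricalMeasure (F D z), inferInstance⟩,
    Measure.isProbabilityMeasure_map (Measurable.of_discrete).aemeasurable⟩

section NoisyAlgorithm

variable {d n : ℕ} [NeZero n] {Y : Type*} [MeasurableSpace Y] [Countable Y]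
  [DiscreteMeasurableSpace Y] (Γ : Measure Y) [IsProbabilityMeasure Γ]
  (F : (Fin n → Cube d) → Y → (Fin n → Cube d))

lemma noisyAlgorithm_apply (D : Fin n → Cube d) {E : Set (ProbabilityMeasure (Cube d))}
    (hE : MeasurableSet E) : (noisyAlgorithm Γ F D : Measure (ProbabilityMeasure (Cube d))) E =
      Γ {z | (⟨empiricalMeasure (F D z), inferInstance⟩ : ProbabilityMeasure (Cube d)) ∈ E} :=
  Measure.map_apply Measurable.of_discrete hE

lemma hasFinitelySupportedOutput_noisyAlgorithm :
    HasFinitelySupportedOutput (noisyAlgorithm Γ F) := by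
  classical
  intro D
  set T : Set (ProbabilityMeasure (Cube d)) := ⋃ z : Y,
    {ν | (ν : Measure (Cube d)) (((Finset.univ.image (F D z) : Finset (Cube d)) :
      Set (Cube d))ᶜ) = 0} with hT
  have hTm : MeasurableSet T := MeasurableSet.iUnion fun z =>
    measurable_probabilityMeasure_apply (Finset.measurableSet _).compl (measurableSet_singleton 0)
  have hae : ∀ᵐ ν ∂(noisyAlgorithm Γ F D : Measure (ProbabilityMeasure (Cube d))), ν ∈ T := by
    refine (ae_map_iff (Measurable.of_discrete).aemeasurable hTm).mpr (.of_forall fun z => ?_)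
    exact Set.mem_iUnion.mpr ⟨z, empiricalMeasure_compl_image_eq_zero (F D z)⟩
  filter_upwards [hae] with ν hν
  obtain ⟨z, hz⟩ := Set.mem_iUnion.mp hν
  exact ⟨_, hz⟩

lemma expectedUtilityLoss_noisyAlgorithm_le (s : ℕ) (D : Fin n → Cube d) :
    expectedUtilityLoss s (noisyAlgorithm Γ F) D ≤
      ∫⁻ z, utilityLoss s (empiricalMeasure D) (empiricalMeasure (F D z)) ∂Γ :=
  lintegral_map_le _ _

end NoisyAlgorithm

lemma utilityLoss_empirical_le_one {d n : ℕ} [NeZero n] (s : ℕ) (D D' : Fin n → Cube d) :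
    utilityLoss s (empiricalMeasure D) (empiricalMeasure D') ≤ 1 := by
  refine iSup₂_le fun S _ => (W1_marginal_le one_pos (Nat.pos_of_neZero n) S D D').trans ?_
  simp [cellMisfit, countBelow]

/-! ### The private algorithm -/

section Mechanism

variable {d n s : ℕ}

/-- The noiseless labels of the trees over the cells of all `s`-dimensional marginals. -/
def dataStat (s L g : ℕ) (D : Fin n → Cube d) (S : {S : Finset (Fin d) // S.card = s}) :
    TreeVec L (g ^ s) :=
  ∑ i, treeStat L (g ^ s) (cellIndex g S.1 (D i))

lemma cellIndex_lt_pow {g : ℕ} (hg : 0 < g) (S : {S : Finset (Fin d) // S.card = s}) (x : Cube d) :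
    cellIndex g S.1 x < g ^ s := by
  simpa only [S.2] using cellIndex_lt hg S.1 x

lemma prefixSum_dataStat {L g : ℕ} (hg : 0 < g) (hL : g ^ s ≤ 2 ^ L) (D : Fin n → Cube d)
    (S : {S : Finset (Fin d) // S.card = s}) (k : Fin (g ^ s)) :
    prefixSum (dataStat s L g D S) k = countBelow (fun i => cellIndex g S.1 (D i)) k := by
  have h : prefixSum (dataStat s L g D S) k =
      ∑ i, prefixSum (treeStat L (g ^ s) (cellIndex g S.1 (D i))) k := by
    simp only [prefixSum, dataStat, Finset.sum_apply]
    exact Finset.sum_comm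
  rw [h, countBelow]
  push_cast
  exact Finset.sum_congr rfl fun i _ => prefixSum_treeStat hL (cellIndex_lt_pow hg S _) k

lemma cellMisfit_eq_treeLoss {L g : ℕ} (hg : 0 < g) (hL : g ^ s ≤ 2 ^ L) (D D' : Fin n → Cube d)
    (S : {S : Finset (Fin d) // S.card = s}) :
    cellMisfit g S.1 D D' = treeLoss (dataStat s L g D S - dataStat s L g D' S) := by
  simp only [cellMisfit, treeLoss, S.2, prefixSum_sub, prefixSum_dataStat hg hL]
  push_cast
  rw [Finset.sum_range]

/-- Changing one entry of the data moves each tree by the difference of two single-point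
contributions. -/
lemma dataStat_sub_of_differInOneEntry {L g : ℕ} {D D' : Fin n → Cube d}
    (h : DifferInOneEntry D D') : ∃ i, ∀ S : {S : Finset (Fin d) // S.card = s},
      dataStat s L g D S - dataStat s L g D' S =
        treeStat L (g ^ s) (cellIndex g S.1 (D i)) - treeStat L (g ^ s) (cellIndex g S.1 (D' i)) := by
  obtain ⟨i, hi⟩ := h
  refine ⟨i, fun S => ?_⟩
  rw [dataStat, dataStat, ← Finset.sum_sub_distrib]
  refine Finset.sum_eq_single i (fun j _ hj => ?_) (by simp)
  rw [hi j hj, sub_self]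

/-- A data set whose tree labels fit the labels `y` best. The loss is a natural number, so the
minimum over all data sets is attained. -/
def reconstruct (d n s L g : ℕ) (y : {S : Finset (Fin d) // S.card = s} → TreeVec L (g ^ s)) :
    Fin n → Cube d :=
  Function.argmin fun D : Fin n → Cube d => maxLoss (y - dataStat s L g D)

lemma maxLoss_reconstruct_le (L g : ℕ) (D : Fin n → Cube d)
    (z : {S : Finset (Fin d) // S.card = s} → TreeVec L (g ^ s)) :
    maxLoss (dataStat s L g D - dataStat s L g (reconstruct d n s L g (dataStat s L g D + z))) ≤
      2 * maxLoss z := by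
  set y := dataStat s L g D + z with hy
  have hmin : maxLoss (y - dataStat s L g (reconstruct d n s L g y)) ≤
      maxLoss (y - dataStat s L g D) :=
    Function.argmin_le (fun D : Fin n → Cube d => maxLoss (y - dataStat s L g D)) D
  have hz : y - dataStat s L g D = z := by rw [hy]; abel
  have hdecomp : dataStat s L g D - dataStat s L g (reconstruct d n s L g y) =
      (y - dataStat s L g (reconstruct d n s L g y)) + -z := by rw [hy]; abel
  rw [hz] at hmin
  rw [hdecomp]
  refine (maxLoss_add_le _ _).trans ?_
  rw [maxLoss_neg]
  omega

lemma utilityLoss_reconstruct_le {L g : ℕ} (hg : 0 < g) (hn : 0 < n) (hL : g ^ s ≤ 2 ^ L)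
    (D : Fin n → Cube d) (z : {S : Finset (Fin d) // S.card = s} → TreeVec L (g ^ s)) :
    utilityLoss s (empiricalMeasure D)
        (empiricalMeasure (reconstruct d n s L g (dataStat s L g D + z))) ≤
      ENNReal.ofReal (2 / (n * g)) * ENNReal.ofReal (maxLoss z) + ENNReal.ofReal (1 / g) := by
  refine iSup₂_le fun S hS => (W1_marginal_le hg hn S D _).trans ?_
  rw [← ENNReal.ofReal_mul (by positivity), ← ENNReal.ofReal_add (by positivity) (by positivity)]
  refine ENNReal.ofReal_le_ofReal ?_
  have h1 := cellMisfit_eq_treeLoss hg hL D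
    (reconstruct d n s L g (dataStat s L g D + z)) ⟨S, hS⟩
  have h2 := (treeLoss_le_maxLoss (dataStat s L g D - dataStat s L g
    (reconstruct d n s L g (dataStat s L g D + z))) ⟨S, hS⟩).trans (maxLoss_reconstruct_le L g D z)
  have h3 : (cellMisfit g S D (reconstruct d n s L g (dataStat s L g D + z)) : ℝ) ≤
      2 * maxLoss z := by
    rw [h1]; exact_mod_cast h2
  have hn' : (0 : ℝ) < n := by exact_mod_cast hn
  have hg' : (0 : ℝ) < g := by exact_mod_cast hg
  calc (cellMisfit g S D (reconstruct d n s L g (dataStat s L g D + z)) / n + 1 : ℝ) / g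
      ≤ (2 * maxLoss z / n + 1) / g := by gcongr
    _ = 2 / (n * g) * maxLoss z + 1 / g := by field_simp

/-- The algorithm with `g` cells in each direction. Half of the privacy budget pays for the Laplace
part of the noise, the other half for the tilt. -/
lemma exists_isDP_algorithm [NeZero n] (hsd : s ≤ d) {ε : ℝ} (hε : 0 < ε) {g : ℕ} (hg : 0 < g) :
    ∃ A : RandomizedAlgorithm d n, IsDP ε A ∧ HasFinitelySupportedOutput A ∧
      ∀ D, expectedUtilityLoss s A D ≤ ENNReal.ofReal
        ((72 * ((Nat.log 2 (g ^ s) + 1 : ℕ) * Real.sqrt (Nat.log 2 (g ^ s) + 1 : ℕ)) *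
          g ^ s * d ^ s / (n * ε) + 1) / g) := by
  set L : ℕ := Nat.log 2 (g ^ s) + 1 with hLdef
  set K : ℕ := g ^ s with hKdef
  set N : ℕ := Fintype.card {S : Finset (Fin d) // S.card = s} with hNdef
  have hNd : N = d.choose s := by rw [hNdef, Fintype.card_finset_len, Fintype.card_fin]
  have hL0 : 0 < L := Nat.succ_pos _
  have hK0 : 0 < K := by positivity
  have hN0 : 0 < N := hNd ▸ Nat.choose_pos hsd
  have hNle : N ≤ d ^ s := hNd ▸ Nat.choose_le_pow d s
  have hn : 0 < n := Nat.pos_of_neZero n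
  have hKL : K ≤ 2 ^ L := (Nat.lt_pow_succ_log_self one_lt_two K).le
  have hL' : (1 : ℝ) ≤ L := by exact_mod_cast hL0
  have hK' : (0 : ℝ) < K := by exact_mod_cast hK0
  have hN' : (1 : ℝ) ≤ N := by exact_mod_cast hN0
  have hn' : (0 : ℝ) < n := by exact_mod_cast hn
  have hg' : (0 : ℝ) < g := by exact_mod_cast hg
  set a : ℝ := ε / (4 * L * N) with ha
  set b : ℝ := ε / (2 * K) with hb
  have ha0 : 0 < a := by positivity
  have hb0 : 0 < b := by positivity
  have := isProbabilityMeasure_noiseLaw (σ := {S : Finset (Fin d) // S.card = s}) (L := L)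
    (K := K) ha0 hb0
  refine ⟨noisyAlgorithm (noiseLaw {S : Finset (Fin d) // S.card = s} L K a b)
    fun D z => reconstruct d n s L g (dataStat s L g D + z), ?_,
    hasFinitelySupportedOutput_noisyAlgorithm _ _, fun D => ?_⟩
  · intro D D' hDD' E hE
    rw [noisyAlgorithm_apply _ _ _ hE, noisyAlgorithm_apply _ _ _ hE]
    refine noiseLaw_shift_le ha0 hb0 (dataStat s L g D) (dataStat s L g D')
      {y | (⟨empiricalMeasure (reconstruct d n s L g y), inferInstance⟩ :
        ProbabilityMeasure (Cube d)) ∈ E} ?_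
    obtain ⟨i, hi⟩ := dataStat_sub_of_differInOneEntry (s := s) (L := L) (g := g) hDD'
    have h1 : ∑ S, ∑ p, |((dataStat s L g D - dataStat s L g D') S p : ℝ)| ≤ N * (2 * L) := by
      refine (Finset.sum_le_card_nsmul _ _ (2 * L : ℝ) fun S _ => ?_).trans_eq
        (by rw [nsmul_eq_mul, Finset.card_univ])
      rw [Pi.sub_apply, hi S]
      exact_mod_cast sum_abs_treeStat_sub_le L K (cellIndex g S.1 (D i)) (cellIndex g S.1 (D' i))
    have h2 : maxLoss (dataStat s L g D - dataStat s L g D') ≤ K :=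
      Finset.sup_le fun S _ => by
        rw [Pi.sub_apply, hi S]
        exact treeLoss_treeStat_sub_le hKL (cellIndex_lt_pow hg S _) (cellIndex_lt_pow hg S _)
    calc a * ∑ S, ∑ p, |((dataStat s L g D - dataStat s L g D') S p : ℝ)| +
          b * maxLoss (dataStat s L g D - dataStat s L g D')
        ≤ a * (N * (2 * L)) + b * K := by
          have h2' : (maxLoss (dataStat s L g D - dataStat s L g D') : ℝ) ≤ K := by
            exact_mod_cast h2
          gcongr
      _ = ε := by rw [ha, hb]; field_simp; ring
  · refine (expectedUtilityLoss_noisyAlgorithm_le _ _ s D).trans ?_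
    refine (lintegral_mono fun z => utilityLoss_reconstruct_le hg hn hKL D z).trans ?_
    rw [lintegral_add_right _ measurable_const, lintegral_const_mul _ (measurable_of_countable _),
      lintegral_const, measure_univ, mul_one]
    refine (add_le_add_left (mul_le_mul_right (lintegral_maxLoss_noiseLaw_le ha0 hb0 hL0 hK0) _)
      _).trans ?_
    rw [← ENNReal.ofReal_mul (by positivity), ← ENNReal.ofReal_add (by positivity) (by positivity)]
    refine ENNReal.ofReal_le_ofReal ?_
    have hsqrt : (1 : ℝ) ≤ L * Real.sqrt L := by
      nlinarith [Real.one_le_sqrt.mpr hL']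
    have hNle' : (N : ℝ) ≤ (d : ℝ) ^ s := by exact_mod_cast hNle
    have hKcast : (g : ℝ) ^ s = K := by rw [hKdef]; push_cast; rfl
    rw [hKcast]
    calc 2 / (n * g) * (8 * K * Real.sqrt L / a + (N + 1) / b) + 1 / g
        = ((64 * (L * Real.sqrt L) * K * N + 4 * K * (N + 1)) / (n * ε) + 1) / g := by
          rw [ha, hb]; field_simp; ring
      _ ≤ (72 * (L * Real.sqrt L) * K * (d : ℝ) ^ s / (n * ε) + 1) / g := by
          have h4 : 4 * (K : ℝ) * (N + 1) ≤ 8 * (L * Real.sqrt L) * K * N := by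
            calc 4 * (K : ℝ) * (N + 1) ≤ 4 * K * (N + N) := by gcongr
              _ = 8 * 1 * K * N := by ring
              _ ≤ 8 * (L * Real.sqrt L) * K * N := by gcongr
          have h5 : 64 * (L * Real.sqrt L) * K * N + 4 * K * (N + 1) ≤
              72 * (L * Real.sqrt L) * K * (d : ℝ) ^ s :=
            calc 64 * (L * Real.sqrt L) * K * N + 4 * K * (N + 1)
                ≤ 72 * (L * Real.sqrt L) * K * N := by linarith
              _ ≤ _ := by gcongr
          gcongr

end Mechanism

/-- The data-independent algorithm, which is useful when the claimed error exceeds the diameter. -/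
lemma exists_isDP_algorithm_trivial {d n : ℕ} [NeZero n] (s : ℕ) {ε : ℝ} (hε : 0 < ε) :
    ∃ A : RandomizedAlgorithm d n, IsDP ε A ∧ HasFinitelySupportedOutput A ∧
      ∀ D, expectedUtilityLoss s A D ≤ 1 := by
  refine ⟨noisyAlgorithm (Measure.dirac ()) fun _ _ _ _ => 0, fun D D' _ E hE => ?_,
    hasFinitelySupportedOutput_noisyAlgorithm _ _, fun D => ?_⟩
  · rw [noisyAlgorithm_apply _ _ _ hE, noisyAlgorithm_apply _ _ _ hE]
    refine le_mul_of_one_le_left zero_le ?_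
    rw [← ENNReal.ofReal_one]
    exact ENNReal.ofReal_le_ofReal (Real.one_le_exp hε.le)
  · refine (expectedUtilityLoss_noisyAlgorithm_le _ _ s D).trans ?_
    refine (lintegral_mono fun z => utilityLoss_empirical_le_one s D _).trans ?_
    simp

/-- The choice of the grid: `g ≈ (m / (dˢ log^{3/2} m))^{1/s}` balances the width of the cells
against the noise. -/
lemma grid_choice_bound {s g : ℕ} (hs : 1 ≤ s) {m q : ℝ} (hm : 2 ≤ m) (hq : 1 ≤ q)
    (hx : q * Real.log m ^ (3 / 2 : ℝ) / m ≤ 1)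
    (hg : g = ⌊(q * Real.log m ^ (3 / 2 : ℝ) / m) ^ (-(1 / (s : ℝ)))⌋₊) :
    0 < g ∧ (72 * ((Nat.log 2 (g ^ s) + 1 : ℕ) * Real.sqrt (Nat.log 2 (g ^ s) + 1 : ℕ)) *
          g ^ s * q / m + 1) / g ≤
      2162 * (q * Real.log m ^ (3 / 2 : ℝ) / m) ^ (1 / (s : ℝ)) := by
  set l := Real.log m with hl
  set x := q * l ^ (3 / 2 : ℝ) / m with hxdef
  have hlog2 : (0.6931471803 : ℝ) < Real.log 2 := Real.log_two_gt_d9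
  have hl2 : Real.log 2 ≤ l := Real.log_le_log (by norm_num) hm
  have hl0 : 0 < l := by linarith
  have hx0 : 0 < x := by positivity
  have hs0 : (0 : ℝ) < s := by exact_mod_cast hs
  set y := x ^ (-(1 / (s : ℝ))) with hy
  have hy1 : 1 ≤ y := Real.one_le_rpow_of_pos_of_le_one_of_nonpos hx0 hx (by
    rw [neg_nonpos]; positivity)
  have hg1 : 1 ≤ g := by rw [hg]; exact (Nat.one_le_floor_iff y).mpr hy1
  have hg0 : (1 : ℝ) ≤ g := by exact_mod_cast hg1
  have hgy : (g : ℝ) ≤ y := by rw [hg]; exact Nat.floor_le (by linarith)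
  have hyg : y ≤ 2 * g := by
    have := Nat.lt_floor_add_one y
    rw [← hg] at this
    linarith
  refine ⟨hg1, ?_⟩
  have hys : y ^ s = x⁻¹ := by
    rw [hy, ← Real.rpow_natCast, ← Real.rpow_mul hx0.le, neg_mul, one_div,
      inv_mul_cancel₀ hs0.ne', Real.rpow_neg_one]
  have hKx : (g : ℝ) ^ s ≤ x⁻¹ := hys ▸ pow_le_pow_left₀ (by linarith) hgy s
  have hl32 : (1 / 4 : ℝ) ≤ l ^ (3 / 2 : ℝ) :=
    calc (1 / 4 : ℝ) = (1 / 2 : ℝ) ^ (2 : ℝ) := by norm_num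
      _ ≤ (1 / 2 : ℝ) ^ (3 / 2 : ℝ) :=
        Real.rpow_le_rpow_of_exponent_ge (by norm_num) (by norm_num) (by norm_num)
      _ ≤ l ^ (3 / 2 : ℝ) := Real.rpow_le_rpow (by norm_num) (by linarith) (by norm_num)
  -- The number of cells is polynomial in `m`, so the depth of the trees is of order `log m`.
  have hxinv : x⁻¹ ≤ 4 * m := by
    rw [inv_le_comm₀ hx0 (by linarith), hxdef, inv_eq_one_div, div_le_div_iff₀ (by linarith)
      (by linarith)]
    nlinarith [mul_nonneg (sub_nonneg.mpr hq) (sub_nonneg.mpr hl32)]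
  set L : ℕ := Nat.log 2 (g ^ s) + 1 with hL
  have hLl : (L : ℝ) ≤ 6 * l := by
    have h1 : (2 : ℝ) ^ Nat.log 2 (g ^ s) ≤ 4 * m := by
      have : 2 ^ Nat.log 2 (g ^ s) ≤ g ^ s := Nat.pow_log_le_self 2 (by positivity)
      have h : (2 : ℝ) ^ Nat.log 2 (g ^ s) ≤ (g : ℝ) ^ s := by exact_mod_cast this
      linarith
    have h2 := Real.log_le_log (by positivity) h1
    rw [Real.log_pow, Real.log_mul (by norm_num) (by linarith), ← hl,
      show (4 : ℝ) = 2 ^ 2 by norm_num, Real.log_pow] at h2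
    push_cast at h2
    have h3 : (L : ℝ) = Nat.log 2 (g ^ s) + 1 := by rw [hL]; push_cast; rfl
    have h4 : (L : ℝ) * Real.log 2 ≤ 4 * l := by rw [h3]; linarith
    nlinarith
  have hLs : (L : ℝ) * Real.sqrt L ≤ 15 * l ^ (3 / 2 : ℝ) := by
    have h1 : ∀ t : ℝ, 0 ≤ t → t * Real.sqrt t = t ^ (3 / 2 : ℝ) := fun t ht => by
      rcases ht.eq_or_lt with rfl | ht
      · rw [Real.zero_rpow (by norm_num), zero_mul]
      · rw [Real.sqrt_eq_rpow]
        nth_rewrite 1 [← Real.rpow_one t]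
        rw [← Real.rpow_add ht]; norm_num
    have h6 : Real.sqrt 6 ≤ 5 / 2 := Real.sqrt_le_iff.mpr (by norm_num)
    calc (L : ℝ) * Real.sqrt L ≤ (6 * l) * Real.sqrt (6 * l) := by gcongr
      _ = 6 * Real.sqrt 6 * (l * Real.sqrt l) := by rw [Real.sqrt_mul (by norm_num)]; ring
      _ ≤ 6 * (5 / 2) * l ^ (3 / 2 : ℝ) := by rw [h1 l hl0.le]; gcongr
      _ = 15 * l ^ (3 / 2 : ℝ) := by ring
  have hmain : 72 * (L * Real.sqrt L) * (g : ℝ) ^ s * q / m ≤ 1080 :=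
    calc 72 * (L * Real.sqrt L) * (g : ℝ) ^ s * q / m
        ≤ 72 * (15 * l ^ (3 / 2 : ℝ)) * x⁻¹ * q / m := by gcongr
      _ = 1080 * (x⁻¹ * x) := by rw [hxdef]; ring
      _ = 1080 := by rw [inv_mul_cancel₀ hx0.ne', mul_one]
  have hxy : x ^ (1 / (s : ℝ)) = y⁻¹ := by rw [hy, Real.rpow_neg hx0.le, inv_inv]
  rw [hxy]
  calc (72 * (L * Real.sqrt L) * (g : ℝ) ^ s * q / m + 1) / g ≤ (1080 + 1) / g := by gcongr
    _ = 2162 * (2 * (g : ℝ))⁻¹ := by field_simp; norm_num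
    _ ≤ 2162 * y⁻¹ := by gcongr

theorem exists_isDP_algorithm_rate {s d n : ℕ} (hs : 1 ≤ s) (hsd : s ≤ d) {ε : ℝ} (hε : 0 < ε)
    (hnε : 2 ≤ (n : ℝ) * ε) :
    ∃ A : RandomizedAlgorithm d n, IsDP ε A ∧ HasFinitelySupportedOutput A ∧
      ∀ D : Fin n → Cube d, expectedUtilityLoss s A D ≤
        ENNReal.ofReal (2162 * ((d : ℝ) ^ s * Real.log ((n : ℝ) * ε) ^ (3 / 2 : ℝ) /
          ((n : ℝ) * ε)) ^ (1 / (s : ℝ))) := by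
  have : NeZero n := ⟨by rintro rfl; norm_num at hnε⟩
  rcases le_total ((d : ℝ) ^ s * Real.log ((n : ℝ) * ε) ^ (3 / 2 : ℝ) / ((n : ℝ) * ε)) 1 with hx | hx
  · have hd : (1 : ℝ) ≤ (d : ℝ) ^ s := one_le_pow₀ (by exact_mod_cast hs.trans hsd)
    obtain ⟨hg, hbound⟩ := grid_choice_bound hs hnε hd hx rfl
    obtain ⟨A, hA, hA', hloss⟩ := exists_isDP_algorithm (n := n) hsd hε hg
    exact ⟨A, hA, hA', fun D => (hloss D).trans (ENNReal.ofReal_le_ofReal hbound)⟩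
  · obtain ⟨A, hA, hA', hloss⟩ := exists_isDP_algorithm_trivial (d := d) (n := n) s hε
    refine ⟨A, hA, hA', fun D => (hloss D).trans ?_⟩
    rw [← ENNReal.ofReal_one]
    refine ENNReal.ofReal_le_ofReal ?_
    have := Real.one_le_rpow hx (z := 1 / (s : ℝ)) (by positivity)
    linarith

/-! ### Group privacy -/

lemma IsDP.le_exp_pow_mul {d n : ℕ} {ε : ℝ} {A : RandomizedAlgorithm d n} (hA : IsDP ε A)
    (D D' : Fin n → Cube d) {E : Set (ProbabilityMeasure (Cube d))} (hE : MeasurableSet E) :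
    (A D : Measure (ProbabilityMeasure (Cube d))) E ≤
      ENNReal.ofReal (Real.exp ε) ^ n * (A D' : Measure (ProbabilityMeasure (Cube d))) E := by
  have key : ∀ k : ℕ, k ≤ n → (A D : Measure (ProbabilityMeasure (Cube d))) E ≤
      ENNReal.ofReal (Real.exp ε) ^ k *
        (A fun i => if (i : ℕ) < k then D' i else D i : Measure (ProbabilityMeasure (Cube d))) E := by
    intro k
    induction k with
    | zero => simp
    | succ k ih =>
      intro hk
      refine (ih (by omega)).trans ?_
      rw [pow_succ, mul_assoc]
      refine mul_le_mul_right (hA _ _ ⟨⟨k, hk⟩, fun j hj => ?_⟩ E hE) _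
      have hne : (j : ℕ) ≠ k := fun h => hj (Fin.ext h)
      have hiff : (j : ℕ) < k + 1 ↔ (j : ℕ) < k := by omega
      simp only [hiff]
  simpa using key n le_rfl

/-! ### Grid points and the mass near them -/

section Grid

variable {d : ℕ} (g : ℕ) (S : Finset (Fin d))

/-- The point with coordinates `c i / g` for `i ∈ S`, and `0` elsewhere. -/
def gridPoint (c : S → Fin g) : Cube d := fun i =>
  if h : i ∈ S then ⟨(c ⟨i, h⟩ : ℝ) / g, by positivity,
    div_le_one_of_le₀ (by exact_mod_cast (c ⟨i, h⟩).2.le) (by positivity)⟩ else 0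

/-- The points whose `S`-projection is at distance less than `1 / (2 g)` from a grid point. -/
def nearGridPoint (c : S → Fin g) : Set (Cube d) :=
  coordProj S ⁻¹' Metric.eball (coordProj S (gridPoint g S c)) (ENNReal.ofReal (1 / (2 * g)))

variable {g S}

lemma measurableSet_nearGridPoint (c : S → Fin g) : MeasurableSet (nearGridPoint g S c) :=
  measurable_coordProj S Metric.isOpen_eball.measurableSet

lemma le_dist_gridPoint {c c' : S → Fin g} (h : c ≠ c') :
    1 / (g : ℝ) ≤ dist (coordProj S (gridPoint g S c)) (coordProj S (gridPoint g S c')) := by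
  obtain ⟨i, hi⟩ := Function.ne_iff.mp h
  refine le_trans ?_ (dist_le_pi_dist _ _ i)
  have hg : (0 : ℝ) < g := by exact_mod_cast (c i).pos
  have h1 : (1 : ℝ) ≤ |((c i : ℕ) : ℝ) - (c' i : ℕ)| := by
    have : ((c i : ℕ) : ℤ) ≠ (c' i : ℕ) := fun h => hi (Fin.ext (by exact_mod_cast h))
    exact_mod_cast Int.one_le_abs (sub_ne_zero.mpr this)
  simp only [Subtype.dist_eq, Real.dist_eq, coordProj, gridPoint, i.2, dite_true]
  rw [← sub_div, abs_div, abs_of_pos hg]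
  gcongr

lemma pairwise_disjoint_nearGridPoint :
    Pairwise (Function.onFun Disjoint (nearGridPoint g S)) := by
  intro c c' hne
  refine Set.disjoint_left.mpr fun x hx hx' => ?_
  simp only [nearGridPoint, Metric.eball_ofReal, Set.mem_preimage, Metric.mem_ball] at hx hx'
  have h1 := le_dist_gridPoint hne
  have h2 := dist_triangle_left (coordProj S (gridPoint g S c)) (coordProj S (gridPoint g S c'))
    (coordProj S x)
  have h3 : 1 / (g : ℝ) = 1 / (2 * g) + 1 / (2 * g) := by ring
  linarith

open Classical in
/-- The grid points near which `ν` has mass at least `1 / (2 n)`. -/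
def heavyPoints (g : ℕ) (S : Finset (Fin d)) (n : ℕ) (ν : Measure (Cube d)) :
    Finset (S → Fin g) :=
  {c | ((2 * n : ℕ) : ℝ≥0∞)⁻¹ ≤ ν (nearGridPoint g S c)}

lemma card_heavyPoints_le {n : ℕ} (hn : 0 < n) (ν : Measure (Cube d)) [IsProbabilityMeasure ν] :
    (heavyPoints g S n ν).card ≤ 2 * n := by
  -- The neighbourhoods are disjoint, so their masses add up to at most one.
  have h1 : ∑ c ∈ heavyPoints g S n ν, ν (nearGridPoint g S c) ≤ 1 := by
    rw [← measure_univ (μ := ν)]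
    exact sum_measure_le_measure_univ
      (fun c _ => (measurableSet_nearGridPoint c).nullMeasurableSet)
      (fun c _ c' _ hne => (pairwise_disjoint_nearGridPoint hne).aedisjoint)
  have h2 : (heavyPoints g S n ν).card • ((2 * n : ℕ) : ℝ≥0∞)⁻¹ ≤
      ∑ c ∈ heavyPoints g S n ν, ν (nearGridPoint g S c) :=
    Finset.card_nsmul_le_sum _ _ _ fun c hc => by
      simpa [heavyPoints] using hc
  have h3 := h2.trans h1
  rw [nsmul_eq_mul, ← div_eq_mul_inv, ENNReal.div_le_iff (by simp [hn.ne']) (ENNReal.natCast_ne_top _),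
    one_mul] at h3
  exact_mod_cast h3

open Classical in
/-- The outputs for which at least half of the entries of the data set `f` lie at heavy points. -/
def heavyEvent {n : ℕ} (f : Fin n → (S → Fin g)) : Set (ProbabilityMeasure (Cube d)) :=
  {ν | n ≤ 2 * ∑ i, if f i ∈ heavyPoints g S n (ν : Measure (Cube d)) then 1 else 0}

lemma measurableSet_heavyEvent {n : ℕ} (f : Fin n → (S → Fin g)) :
    MeasurableSet (heavyEvent f) := by
  classical
  refine measurableSet_le measurable_const (Measurable.const_mul ?_ 2)
  refine Finset.measurable_sum _ fun i _ => Measurable.ite ?_ measurable_const measurable_const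
  simp only [heavyPoints, Finset.mem_filter, Finset.mem_univ, true_and]
  exact measurableSet_le measurable_const
    (measurable_probabilityMeasure_apply (measurableSet_nearGridPoint _))

/-- If most entries of the data set lie at light points, then a coupling has to move a quarter of
the mass away from the grid points by at least `1 / (2 g)`. -/
lemma le_W1_of_light {n : ℕ} (hn : 0 < n) (f : Fin n → (S → Fin g))
    (ν : Measure (Cube d)) [IsProbabilityMeasure ν] {M : ℕ}
    (hM : M = (Finset.univ.filter fun i => f i ∉ heavyPoints g S n ν).card) (hMn : n ≤ 2 * M) :
    ENNReal.ofReal (1 / (8 * g)) ≤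
      W1 ((empiricalMeasure fun i => gridPoint g S (f i)).map (coordProj S))
        (ν.map (coordProj S)) := by
  classical
  refine le_iInf₂ fun π hπ => ?_
  set pt : (S → Fin g) → (S → unitInterval) := fun c => coordProj S (gridPoint g S c) with hpt
  set Q : Finset (S → Fin g) :=
    (Finset.univ.filter fun i => f i ∉ heavyPoints g S n ν).image f with hQ
  set far : Set ((S → unitInterval) × (S → unitInterval)) :=
    {p | ENNReal.ofReal (1 / (2 * g)) ≤ edist p.1 p.2} with hfar
  have hfirst : (n : ℝ≥0∞)⁻¹ * M ≤ π (Prod.fst ⁻¹' (pt '' Q)) := by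
    rw [← Measure.map_apply measurable_fst (Q.finite_toSet.image pt).measurableSet, hπ.1,
      map_empiricalMeasure (measurable_coordProj S), Measure.smul_apply, smul_eq_mul,
      Measure.finsetSum_apply]
    refine mul_le_mul_right ?_ _
    rw [hM, Finset.card_filter]
    push_cast
    refine Finset.sum_le_sum fun i _ => ?_
    by_cases hi : f i ∈ heavyPoints g S n ν
    · simp [hi]
    · have hmem : coordProj S (gridPoint g S (f i)) ∈ pt '' Q :=
        ⟨f i, Finset.mem_coe.mpr (Finset.mem_image_of_mem f (by simpa using hi)), rfl⟩
      rw [Measure.dirac_apply_of_mem hmem, if_pos hi]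
  have hnear : π (Prod.fst ⁻¹' (pt '' Q) \ far) ≤
      M * ((2 * n : ℕ) : ℝ≥0∞)⁻¹ := by
    have hsub : Prod.fst ⁻¹' (pt '' Q) \ far ⊆
        ⋃ c ∈ Q, Prod.snd ⁻¹' Metric.eball (pt c) (ENNReal.ofReal (1 / (2 * g))) := by
      rintro ⟨x, y⟩ ⟨hx, hxy⟩
      obtain ⟨c, hc, rfl⟩ := hx
      simp only [hfar, Set.mem_ofPred_eq, not_le] at hxy
      refine Set.mem_biUnion hc ?_
      rw [Set.mem_preimage, Metric.mem_eball, edist_comm]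
      exact hxy
    calc π (Prod.fst ⁻¹' (pt '' Q) \ far)
        ≤ ∑ c ∈ Q, π (Prod.snd ⁻¹' Metric.eball (pt c) (ENNReal.ofReal (1 / (2 * g)))) :=
          (measure_mono hsub).trans (measure_biUnion_finset_le _ _)
      _ ≤ ∑ _c ∈ Q, ((2 * n : ℕ) : ℝ≥0∞)⁻¹ := by
          refine Finset.sum_le_sum fun c hc => ?_
          rw [← Measure.map_apply measurable_snd Metric.isOpen_eball.measurableSet, hπ.2,
            Measure.map_apply (measurable_coordProj S) Metric.isOpen_eball.measurableSet]
          obtain ⟨i, hi, rfl⟩ := Finset.mem_image.mp hc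
          have hi' := (Finset.mem_filter.mp hi).2
          simp only [heavyPoints, Finset.mem_filter, Finset.mem_univ, true_and, not_le] at hi'
          exact hi'.le
      _ = Q.card * ((2 * n : ℕ) : ℝ≥0∞)⁻¹ := by simp
      _ ≤ M * ((2 * n : ℕ) : ℝ≥0∞)⁻¹ := by
          gcongr
          rw [hM]
          exact Finset.card_image_le
  have hfar4 : ENNReal.ofReal (1 / 4) ≤ π far := by
    have hsplit : (n : ℝ≥0∞)⁻¹ * M ≤ M * ((2 * n : ℕ) : ℝ≥0∞)⁻¹ + π far := by
      refine hfirst.trans (le_trans ?_ (add_le_add_left hnear (π far)))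
      refine (measure_mono fun p hp => ?_).trans (measure_union_le _ _)
      by_cases h : p ∈ far
      exacts [Or.inr h, Or.inl ⟨hp, h⟩]
    have hn' : (0 : ℝ) < n := by exact_mod_cast hn
    have e1 : (n : ℝ≥0∞)⁻¹ * M = ENNReal.ofReal (M / (2 * n)) + ENNReal.ofReal (M / (2 * n)) := by
      rw [← ENNReal.ofReal_add (by positivity) (by positivity), ← ENNReal.ofReal_natCast n,
        ← ENNReal.ofReal_natCast M, ← ENNReal.ofReal_inv_of_pos hn',
        ← ENNReal.ofReal_mul (by positivity)]
      congr 1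
      field_simp
      ring
    have e2 : (M : ℝ≥0∞) * ((2 * n : ℕ) : ℝ≥0∞)⁻¹ = ENNReal.ofReal (M / (2 * n)) := by
      rw [← ENNReal.ofReal_natCast (2 * n), ← ENNReal.ofReal_natCast M,
        ← ENNReal.ofReal_inv_of_pos (by push_cast; positivity), ← ENNReal.ofReal_mul (by positivity)]
      congr 1
      push_cast
      rw [div_eq_mul_inv]
    rw [e1, e2] at hsplit
    refine le_trans (ENNReal.ofReal_le_ofReal ?_)
      (ENNReal.le_of_add_le_add_left ENNReal.ofReal_ne_top hsplit)
    have hMn' : (n : ℝ) ≤ 2 * M := by exact_mod_cast hMn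
    rw [div_le_div_iff₀ (by norm_num) (by positivity)]
    linarith
  calc ENNReal.ofReal (1 / (8 * g))
      = ENNReal.ofReal (1 / (2 * g)) * ENNReal.ofReal (1 / 4) := by
        rw [← ENNReal.ofReal_mul (by positivity)]
        congr 1
        ring
    _ ≤ ENNReal.ofReal (1 / (2 * g)) * π far := by gcongr
    _ ≤ ∫⁻ p, edist p.1 p.2 ∂π := mul_meas_ge_le_lintegral measurable_edist _

lemma le_utilityLoss_of_notMem_heavyEvent {s n : ℕ} (hn : 0 < n) (hS : S.card = s)
    (f : Fin n → (S → Fin g)) {ν : ProbabilityMeasure (Cube d)} (hν : ν ∉ heavyEvent f) :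
    ENNReal.ofReal (1 / (8 * g)) ≤
      utilityLoss s (empiricalMeasure fun i => gridPoint g S (f i)) (ν : Measure (Cube d)) := by
  classical
  refine le_trans (le_W1_of_light hn f (ν : Measure (Cube d)) rfl ?_) (le_iSup₂_of_le S hS le_rfl)
  have h1 := Finset.card_filter_add_card_filter_not (s := (Finset.univ : Finset (Fin n)))
    (fun i => f i ∈ heavyPoints g S n (ν : Measure (Cube d)))
  simp only [heavyEvent, Set.mem_ofPred_eq, not_le, ← Finset.card_filter] at hν
  rw [Finset.card_univ, Fintype.card_fin] at h1
  omega

/-! ### Counting data sets -/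

/-- Few data sets have half of their entries in a given small set `H`: each entry in `H` is
rewarded by a factor `q²`, and the resulting sum over all data sets factorizes. -/
lemma card_filter_half_mem_mul_le {ι : Type*} [Fintype ι] [DecidableEq ι] {n : ℕ} (H : Finset ι) {q : ℝ}
    (hq : 1 ≤ q) :
    ((Finset.univ.filter fun f : Fin n → ι =>
      n ≤ 2 * ∑ i, if f i ∈ H then 1 else 0).card : ℝ) * q ^ n ≤
      (H.card * q ^ 2 + Fintype.card ι) ^ n := by
  set w : ι → ℝ := fun c => if c ∈ H then q ^ 2 else 1 with hw
  have hw0 : ∀ c, 0 ≤ w c := fun c => by simp only [hw]; split_ifs <;> positivity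
  have hprod : ∀ f : Fin n → ι, ∏ i, w (f i) = q ^ (2 * ∑ i, if f i ∈ H then 1 else 0) := by
    intro f
    rw [pow_mul, ← Finset.prod_pow_eq_pow_sum]
    refine Finset.prod_congr rfl fun i _ => ?_
    simp only [hw]
    split_ifs <;> simp
  calc ((Finset.univ.filter fun f : Fin n → ι =>
        n ≤ 2 * ∑ i, if f i ∈ H then 1 else 0).card : ℝ) * q ^ n
      = ∑ _f ∈ Finset.univ.filter fun f : Fin n → ι =>
        n ≤ 2 * ∑ i, if f i ∈ H then 1 else 0, q ^ n := by simp
    _ ≤ ∑ f ∈ Finset.univ.filter fun f : Fin n → ι =>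
        n ≤ 2 * ∑ i, if f i ∈ H then 1 else 0, ∏ i, w (f i) := by
        refine Finset.sum_le_sum fun f hf => ?_
        rw [hprod]
        exact pow_le_pow_right₀ hq (Finset.mem_filter.mp hf).2
    _ ≤ ∑ f : Fin n → ι, ∏ i, w (f i) :=
        Finset.sum_le_sum_of_subset_of_nonneg (Finset.filter_subset _ _)
          fun f _ _ => Finset.prod_nonneg fun i _ => hw0 _
    _ = (∑ c, w c) ^ n := (Fintype.sum_pow w n).symm
    _ ≤ (H.card * q ^ 2 + Fintype.card ι) ^ n := by
        refine pow_le_pow_left₀ (Finset.sum_nonneg fun c _ => hw0 c) ?_ n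
        calc ∑ c, w c ≤ ∑ c, ((if c ∈ H then q ^ 2 else 0) + 1) := by
              refine Finset.sum_le_sum fun c _ => ?_
              simp only [hw]
              split_ifs <;> simp
          _ = H.card * q ^ 2 + Fintype.card ι := by
              rw [Finset.sum_add_distrib]
              simp

open Classical in
lemma card_heavyEvent_le {n : ℕ} (hn : 0 < n) {q : ℝ} (hq : 1 ≤ q)
    (hG : 2 * q ^ 2 * n ≤ (g : ℝ) ^ S.card) (ν : ProbabilityMeasure (Cube d)) :
    ((Finset.univ.filter fun f : Fin n → (S → Fin g) => ν ∈ heavyEvent f).card : ℝ) ≤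
      ((g : ℝ) ^ S.card * (2 / q)) ^ n := by
  have hq0 : 0 < q := by linarith
  have h1 := card_filter_half_mem_mul_le (n := n)
    (heavyPoints g S n (ν : Measure (Cube d))) hq
  have h2 : ((heavyPoints g S n (ν : Measure (Cube d))).card : ℝ) ≤ 2 * n := by
    exact_mod_cast card_heavyPoints_le hn (ν : Measure (Cube d))
  have h3 : (Fintype.card (S → Fin g) : ℝ) = (g : ℝ) ^ S.card := by simp
  have h4 : (Finset.univ.filter fun f : Fin n → (S → Fin g) => ν ∈ heavyEvent f) =
      Finset.univ.filter fun f : Fin n → (S → Fin g) =>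
        n ≤ 2 * ∑ i, if f i ∈ heavyPoints g S n (ν : Measure (Cube d)) then 1 else 0 := by
    ext f
    rw [Finset.mem_filter, Finset.mem_filter, heavyEvent, Set.mem_ofPred_eq]
  rw [← mul_div_assoc, div_pow, le_div_iff₀ (by positivity), h4]
  refine h1.trans (pow_le_pow_left₀ (by positivity) ?_ n)
  rw [h3]
  nlinarith [mul_le_mul_of_nonneg_right h2 (sq_nonneg q)]

end Grid

/-! ### The lower bound -/

/-- If all data sets on the grid were served well, each of the events `heavyEvent f` would have
probability at least `1 / 2` under its own data set, hence probability at least `exp (-ε n) / 2`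
under one fixed data set. A given output belongs to too few of them for this. -/
lemma exists_le_expectedUtilityLoss {d s n g : ℕ} (hn : 0 < n) {S : Finset (Fin d)}
    (hS : S.card = s) {ε : ℝ} (hε : 0 < ε)
    (hG : 2 * (8 * Real.exp ε) ^ 2 * n ≤ (g : ℝ) ^ s) {A : RandomizedAlgorithm d n}
    (hA : IsDP ε A) :
    ∃ D : Fin n → Cube d, ENNReal.ofReal (1 / (16 * g)) ≤ expectedUtilityLoss s A D := by
  classical
  by_contra! hcon
  have hn' : (1 : ℝ) ≤ n := by exact_mod_cast hn
  have hq : (1 : ℝ) ≤ 8 * Real.exp ε := by linarith [Real.one_le_exp hε.le]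
  have hGpos : 0 < (g : ℝ) ^ s := lt_of_lt_of_le (by positivity) hG
  have hg : (0 : ℝ) < g := by
    by_contra h
    have hg0 : (g : ℝ) = 0 := le_antisymm (not_lt.mp h) (by positivity)
    -- For `g = 0` the bound `1 / (16 g)` is zero, and no loss lies below it.
    have h := hcon fun _ => 0
    simp [hg0] at h
  have hhalf : ∀ f : Fin n → (S → Fin g), ENNReal.ofReal (1 / 2) ≤
      (A fun i => gridPoint g S (f i) : Measure (ProbabilityMeasure (Cube d))) (heavyEvent f) := by
    intro f
    set P : Measure (ProbabilityMeasure (Cube d)) :=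
      (A fun i => gridPoint g S (f i) : Measure (ProbabilityMeasure (Cube d))) with hP
    have h1 : ENNReal.ofReal (1 / (8 * g)) * P (heavyEvent f)ᶜ ≤
        expectedUtilityLoss s A fun i => gridPoint g S (f i) := by
      rw [← lintegral_indicator_const (measurableSet_heavyEvent f).compl]
      refine lintegral_mono fun ν => ?_
      by_cases hν : ν ∈ heavyEvent f
      · simp [hν]
      · rw [Set.indicator_of_mem hν]
        exact le_utilityLoss_of_notMem_heavyEvent hn hS f hν
    have h2 : P (heavyEvent f)ᶜ ≤ ENNReal.ofReal (1 / 2) := by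
      have h3 := h1.trans (hcon _).le
      have h4 : ENNReal.ofReal (1 / (16 * (g : ℝ))) =
          ENNReal.ofReal (1 / (8 * g)) * ENNReal.ofReal (1 / 2) := by
        rw [← ENNReal.ofReal_mul (by positivity)]
        congr 1
        field_simp
        norm_num
      rw [h4] at h3
      exact (ENNReal.mul_le_mul_iff_right (by
        rw [Ne, ENNReal.ofReal_eq_zero, not_le]; positivity) ENNReal.ofReal_ne_top).mp h3
    have h5 := prob_add_prob_compl (μ := P) (measurableSet_heavyEvent f)
    have h6 : (1 : ℝ≥0∞) = ENNReal.ofReal (1 / 2) + ENNReal.ofReal (1 / 2) := by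
      rw [← ENNReal.ofReal_add (by norm_num) (by norm_num)]; norm_num
    rw [h6] at h5
    refine ENNReal.le_of_add_le_add_right (a := ENNReal.ofReal (1 / 2)) ENNReal.ofReal_ne_top ?_
    rw [← h5]
    gcongr
  set D₀ : Fin n → Cube d := fun _ => 0 with hD₀
  set P₀ : Measure (ProbabilityMeasure (Cube d)) :=
    (A D₀ : Measure (ProbabilityMeasure (Cube d))) with hP₀
  have hsum_low : (Fintype.card (Fin n → (S → Fin g)) : ℝ≥0∞) * ENNReal.ofReal (1 / 2) ≤
      ENNReal.ofReal (Real.exp ε) ^ n *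
        ∑ f : Fin n → (S → Fin g), P₀ (heavyEvent f) := by
    rw [Finset.mul_sum, ← nsmul_eq_mul, ← Finset.card_univ]
    exact Finset.card_nsmul_le_sum _ _ _ fun f _ =>
      (hhalf f).trans (hA.le_exp_pow_mul _ _ (measurableSet_heavyEvent f))
  have hsum_high : ∑ f : Fin n → (S → Fin g), P₀ (heavyEvent f) ≤
      ENNReal.ofReal (((g : ℝ) ^ s * (2 / (8 * Real.exp ε))) ^ n) := by
    have h1 : ∀ f : Fin n → (S → Fin g), P₀ (heavyEvent f) =
        ∫⁻ ν, (heavyEvent f).indicator 1 ν ∂P₀ := fun f =>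
      (lintegral_indicator_one (measurableSet_heavyEvent f)).symm
    simp only [h1]
    rw [← lintegral_finsetSum _ fun f _ =>
      measurable_one.indicator (measurableSet_heavyEvent f)]
    refine (lintegral_mono (g := fun _ =>
      ENNReal.ofReal (((g : ℝ) ^ s * (2 / (8 * Real.exp ε))) ^ n)) fun ν => ?_).trans (by simp)
    have h2 := card_heavyEvent_le (g := g) (S := S) hn hq (by rwa [hS]) ν
    rw [hS] at h2
    refine le_trans (le_of_eq ?_) (ENNReal.ofReal_le_ofReal h2)
    simp [Set.indicator_apply, ENNReal.ofReal_natCast]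
  have hfinal := hsum_low.trans (mul_le_mul_right hsum_high _)
  have hcard : (Fintype.card (Fin n → (S → Fin g)) : ℝ≥0∞) =
      ENNReal.ofReal (((g : ℝ) ^ s) ^ n) := by
    rw [← ENNReal.ofReal_natCast]
    congr 1
    simp [hS]
  rw [hcard, ← ENNReal.ofReal_pow (Real.exp_pos _).le, ← ENNReal.ofReal_mul (by positivity),
    ← ENNReal.ofReal_mul (by positivity), ENNReal.ofReal_le_ofReal_iff (by positivity),
    ← mul_pow] at hfinal
  -- The reward `q = 8 exp ε` outweighs the factor `exp ε` per entry lost to group privacy.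
  have h7 : Real.exp ε * ((g : ℝ) ^ s * (2 / (8 * Real.exp ε))) = (g : ℝ) ^ s * (1 / 4) := by
    field_simp
    norm_num
  rw [h7, mul_pow] at hfinal
  have h8 := le_of_mul_le_mul_left hfinal (by positivity)
  have h9 : (1 / 4 : ℝ) ^ n ≤ 1 / 4 := pow_le_of_le_one (by norm_num) (by norm_num) hn.ne'
  linarith

theorem exists_expectedUtilityLoss_rate {s : ℕ} (hs : 1 ≤ s) {ε : ℝ} (hε : 0 < ε) :
    ∃ c : ℝ, 0 < c ∧ ∀ d : ℕ, s ≤ d → ∀ n : ℕ, 1 ≤ n → ∀ A : RandomizedAlgorithm d n, IsDP ε A →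
      ∃ D : Fin n → Cube d,
        ENNReal.ofReal (c * (n : ℝ) ^ (-(1 / (s : ℝ)))) ≤ expectedUtilityLoss s A D := by
  obtain ⟨B, hB⟩ : ∃ B : ℝ, B = 2 * (8 * Real.exp ε) ^ 2 := ⟨_, rfl⟩
  have hB1 : 1 ≤ B := by
    rw [hB]
    have := Real.one_le_exp hε.le
    nlinarith
  have hs0 : (0 : ℝ) < s := by exact_mod_cast hs
  refine ⟨1 / (32 * B ^ (1 / (s : ℝ))), by positivity, fun d hsd n hn A hA => ?_⟩
  have hn' : (1 : ℝ) ≤ n := by exact_mod_cast hn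
  obtain ⟨S, -, hS⟩ := Finset.exists_subset_card_eq (s := (Finset.univ : Finset (Fin d))) (n := s)
    (by simpa using hsd)
  set y : ℝ := (B * n) ^ (1 / (s : ℝ)) with hy
  have hy1 : 1 ≤ y := Real.one_le_rpow (by nlinarith) (by positivity)
  have hyg : y ≤ ⌈y⌉₊ := Nat.le_ceil y
  have hgy : (⌈y⌉₊ : ℝ) ≤ 2 * y := by
    have := Nat.ceil_lt_add_one (by linarith : 0 ≤ y)
    linarith
  have hys : y ^ s = B * n := by
    rw [hy, ← Real.rpow_natCast, ← Real.rpow_mul (by positivity), one_div,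
      inv_mul_cancel₀ hs0.ne', Real.rpow_one]
  -- With this `g` the grid has at least `B n` points, and `g ≤ 2 (B n)^{1/s}`.
  obtain ⟨D, hD⟩ := exists_le_expectedUtilityLoss (g := ⌈y⌉₊) hn hS hε
    (by rw [← hB, ← hys]; exact pow_le_pow_left₀ (by linarith) hyg s) hA
  refine ⟨D, le_trans (ENNReal.ofReal_le_ofReal ?_) hD⟩
  calc 1 / (32 * B ^ (1 / (s : ℝ))) * (n : ℝ) ^ (-(1 / (s : ℝ))) = 1 / (16 * (2 * y)) := by
        rw [hy, Real.mul_rpow (by positivity) (by positivity), Real.rpow_neg (by positivity)]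
        field_simp
        norm_num
    _ ≤ 1 / (16 * ⌈y⌉₊) := by gcongr

end

theorem mainTheorem2 (s : ℕ) (hs : 1 ≤ s) :
    -- upper bound, with a constant that depends on `s` only
    (∃ C : ℝ, 0 < C ∧ ∀ d : ℕ, s ≤ d → ∀ (n : ℕ) (ε : ℝ), 0 < ε → 2 ≤ (n : ℝ) * ε →
      ∃ A : RandomizedAlgorithm d n, IsDP ε A ∧ HasFinitelySupportedOutput A ∧
        ∀ D : Fin n → Cube d,
          expectedUtilityLoss s A D ≤
            ENNReal.ofReal (C * ((d : ℝ) ^ s * Real.log ((n : ℝ) * ε) ^ (3 / 2 : ℝ) /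
              ((n : ℝ) * ε)) ^ (1 / (s : ℝ)))) ∧
    -- optimality of the rate as a function of `n`, up to logarithmic factors
    (∀ ε : ℝ, 0 < ε → ∃ c : ℝ, 0 < c ∧ ∀ d : ℕ, s ≤ d → ∀ n : ℕ, 1 ≤ n →
      ∀ A : RandomizedAlgorithm d n, IsDP ε A →
        ∃ D : Fin n → Cube d,
          ENNReal.ofReal (c * (n : ℝ) ^ (-(1 / (s : ℝ)))) ≤ expectedUtilityLoss s A D) := by
  refine ⟨⟨2162, by norm_num, fun d hsd n ε hε hnε => exists_isDP_algorithm_rate hs hsd hε hnε⟩,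
    fun ε hε => exists_expectedUtilityLoss_rate hs hε⟩
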